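/- For $d\ge 1$, $\mathbf n\in\mathbb N^d$ (positive integers) and $\mathbf z\in\mathbb C^d$, let $\operatorname{Li}_{\mathbf n}(\mathbf z)=\operatorname{Li}_{n_1,\dots,n_d}(z_1,\dots,z_d)$ denote the multiple polylogarithm, i.e. the value at $\mathbf z$ of the analytic continuation, along the straight path from $\mathbf 0$ to $\mathbf z$, of the germ at $\mathbf 0$ given by $$\sum_{0<k_1<\cdots<k_d}\frac{z_1^{k_1}\cdots z_d^{k_d}}{k_1^{n_1}\cdots k_d^{n_d}}.$$ Write $|\mathbf n|=n_1+\cdots+n_d$, $1/\mathbf z=(1/z_1,\dots,1/z_d)$, and $$\operatorname{PLi}_{\mathbf n}(\mathbf z)=\operatorname{Li}_{\mathbf n}(\mathbf z)-(-1)^{|\mathbf n|-d}\operatorname{Li}_{\mathbf n}(1/\mathbf z),\qquad \beta_k(z)=\frac{(2\pi i)^k}{k!}\,B_k\!\left(\frac12+\frac{\log(-z)}{2\pi i}\right)\quad(k\ge 0),$$ where $B_k$ is the $k$-th Bernoulli polynomial, $\frac{te^{xt}}{e^t-1}=\sum_{k\ge0}B_k(x)\frac{t^k}{k!}$, and $\log$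 is the principal branch of the logarithm. Let $n_1,n_2\ge 1$ be integers, $\mathbf n=(n_1,n_2)$, and let $\mathbf z=(z_1,z_2)\in\mathbb C^2$ with $z_1,\ z_2,\ z_1z_2\notin[0,\infty)$. Then all the continuations occurring below exist, and $$\begin{aligned} \operatorname{PLi}_{n_1,n_2}(z_1,z_2) &=\operatorname{Li}_{n_1,n_2}(z_1,z_2)-(-1)^{|\mathbf n|}\operatorname{Li}_{n_1,n_2}\!\left(\tfrac1{z_1},\tfrac1{z_2}\right)\\ &=(-1)^{n_1}\sum_{\mu=n_1}^{|\mathbf n|}\binom{\mu-1}{n_1-1}\operatorname{Li}_\mu(z_1)\,\beta_{|\mathbf n|-\mu}(z_1z_2)\,(-1)^\mu-\operatorname{Li}_{|\mathbf n|}(z_1z_2)\\ &\quad+(-1)^{n_2}\sum_{\mu=n_2}^{|\mathbf n|}\binom{\mu-1}{n_2-1}\operatorname{Li}_\mu\!\left(\tfrac1{z_2}\right)\beta_{|\mathbf n|-\mu}(z_1z_2)-\operatorname{Li}_{n_1}(z_1)\,\beta_{n_2}(z_2). \end{aligned}$$ -/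

import Mathlib

open Filter Topology

noncomputable section

/-- The defining power series of the multiple polylogarithm,
`∑_{0 < k₁ < ⋯ < k_d} z₁^{k₁} ⋯ z_d^{k_d} / (k₁^{n₁} ⋯ k_d^{n_d})`
(absolutely convergent if all `|zᵢ| < 1`). -/
def mplSeries {d : ℕ} (n : Fin d → ℕ) (z : Fin d → ℂ) : ℂ :=
  ∑' k : {k : Fin d → ℕ // StrictMono k ∧ ∀ i, 0 < k i},
    ∏ i, z i ^ k.1 i / (k.1 i : ℂ) ^ n i

/-- `F` is an analytic continuation of the series `mplSeries n` along the straight path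
`t ↦ t • z`, `t ∈ [0, 1]`: it is analytic (in all `d` variables jointly) at every point of the
segment from `0` to `z`, and agrees with the series near `0`. -/
def IsMPLContinuation {d : ℕ} (n : Fin d → ℕ) (z : Fin d → ℂ) (F : (Fin d → ℂ) → ℂ) : Prop :=
  AnalyticOnNhd ℂ F (segment ℝ 0 z) ∧ F =ᶠ[𝓝 0] mplSeries n

/-- The series can be continued analytically along the straight path from `0` to `z`. -/
def MPLDefined {d : ℕ} (n : Fin d → ℕ) (z : Fin d → ℂ) : Prop :=
  ∃ F : (Fin d → ℂ) → ℂ, IsMPLContinuation n z F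

open Classical in
/-- The multiple polylogarithm `Li_n(z)`: the value at `z` of the analytic continuation of the
series along the straight path from `0` to `z` (and `0` if there is no such continuation). -/
def mpl {d : ℕ} (n : Fin d → ℕ) (z : Fin d → ℂ) : ℂ :=
  if h : MPLDefined n z then h.choose z else 0

/-- The value does not depend on the chosen continuation. -/
theorem IsMPLContinuation.mpl_eq {d : ℕ} {n : Fin d → ℕ} {z : Fin d → ℂ}
    {F : (Fin d → ℂ) → ℂ} (hF : IsMPLContinuation n z F) : mpl n z = F z := by
  have h : MPLDefined n z := ⟨F, hF⟩
  have hG := h.choose_spec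
  rw [mpl, dif_pos h]
  exact hG.1.eqOn_of_preconnected_of_eventuallyEq hF.1
    (convex_segment (𝕜 := ℝ) (0 : Fin d → ℂ) z).isPreconnected (left_mem_segment ℝ 0 z)
    (hG.2.trans hF.2.symm) (right_mem_segment ℝ 0 z)

/-- The classical polylogarithm `Li_m(w)`, the case of depth one. -/
def polyLi (m : ℕ) (w : ℂ) : ℂ := mpl ![m] ![w]

/-- `PLi_n(z) = Li_n(z) - (-1)^(|n| - d) Li_n(1/z)`. -/
def parityMPL {d : ℕ} (n : Fin d → ℕ) (z : Fin d → ℂ) : ℂ :=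
  mpl n z - (-1 : ℂ) ^ ((∑ i, (n i : ℤ)) - (d : ℤ)) * mpl n (fun i => 1 / z i)

/-- `β_k(w) = (2πi)^k / k! · B_k(1/2 + log(-w) / (2πi))`, with the `k`-th Bernoulli polynomial
`B_k` and the principal branch of the logarithm. -/
def berPoly (k : ℕ) (w : ℂ) : ℂ :=
  (2 * (Real.pi : ℂ) * Complex.I) ^ k / (k.factorial : ℂ) *
    Polynomial.aeval (1 / 2 + Complex.log (-w) / (2 * (Real.pi : ℂ) * Complex.I))
      (Polynomial.bernoulli k)

/-- The ray `[0, ∞)` in the complex plane. -/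
def nonnegRay : Set ℂ := {w | ∃ r : ℝ, 0 ≤ r ∧ w = (r : ℂ)}

end

/-! Consider the sum of `z₁^p z₂^q / (p^n₁ q^n₂)` over nonzero integers `p`, `q`, with `|z₁| = |z₂|
= 1` and `n₁, n₂ ≥ 2`, where everything converges absolutely. For `p ≠ 0` the indicators satisfy
`[0<p<q] - [p<0, q<p] = [0<p] - [0<p=q] - [q<p]`. The left side gives the two double polylogarithms
of the parity combination. On the right, the half plane `0 < p` is a product of a polylogarithm and
the Fourier series of a Bernoulli polynomial, the diagonal is `Li(z₁z₂)`, and the region `q < p` is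
summed along the lines `p - q = l`. On each line partial fractions reduce the sum to Fourier series
in `z₁z₂`; summing over `l` then gives polylogarithms at `z₁` and `1/z₂`
(`hasSum_zpow_partialFraction`, `hasSum_doubleLiTerm_gt`, `parityDefect_torus`).

Two reductions lead to this case. The operators `z_i ∂/∂z_i` lower an index by one in every
ingredient, and in the difference of the two sides `parityDefect`; hence vanishing for higher
indices implies vanishing for lower ones, without constants of integration. Each component of the
domain in one variable is a sector, which meets the unit circle in an arc, so the identity theorem
extends vanishing on the torus to the whole domain (`eq_zero_of_eq_zero_on_circle`).

The continuations are explicit: a bounded functional on `C([0,1]², ℂ)` applied to a kernel made of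
inverses in this Banach algebra. This yields existence, joint analyticity and the series at once. -/

open scoped unitInterval

/-! ### A bounded functional that produces the denominators -/

/-- The average of `φ` over the orbit of the scaling `m`, as a bounded operator on `C(X, ℂ)`. -/
noncomputable def scalingAverage {X : Type*} [TopologicalSpace X] [CompactSpace X]
    [FirstCountableTopology X] [LocallyCompactSpace X]
    (m : C(I × X, X)) : C(X, ℂ) →L[ℂ] C(X, ℂ) :=
  LinearMap.mkContinuous
    { toFun := fun φ => ⟨fun p => ∫ x : I, φ (m (x, p)), by
        simpa using continuous_parametric_integral_of_continuous (μ := MeasureTheory.volume)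
          (f := fun p (x : I) => φ (m (x, p))) (by unfold Function.uncurry; fun_prop)
          isCompact_univ⟩
      map_add' := fun φ ψ => by
        ext p
        simp only [ContinuousMap.add_apply, ContinuousMap.coe_mk]
        exact MeasureTheory.integral_add
          (Continuous.integrable_of_hasCompactSupport (by fun_prop)
            (HasCompactSupport.of_compactSpace _))
          (Continuous.integrable_of_hasCompactSupport (by fun_prop)
            (HasCompactSupport.of_compactSpace _))
      map_smul' := fun c φ => by
        ext p
        simp [MeasureTheory.integral_const_mul] }
    1 (fun φ => by
      rw [one_mul]
      refine (ContinuousMap.norm_le _ (norm_nonneg _)).2 fun p => ?_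
      have := MeasureTheory.norm_integral_le_of_norm_le_const (μ := (MeasureTheory.volume : MeasureTheory.Measure I))
        (f := fun x : I => φ (m (x, p))) (C := ‖φ‖) (Eventually.of_forall fun x => φ.norm_coe_le_norm _)
      simpa using this)

theorem scalingAverage_apply {X : Type*} [TopologicalSpace X] [CompactSpace X]
    [FirstCountableTopology X] [LocallyCompactSpace X]
    (m : C(I × X, X)) (φ : C(X, ℂ)) (p : X) :
    scalingAverage m φ p = ∫ x : I, φ (m (x, p)) := rfl

theorem integral_unitInterval_pow (k : ℕ) : ∫ x : I, ((x : ℝ) : ℂ) ^ k = 1 / ((k : ℂ) + 1) := by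
  have h := MeasureTheory.integral_subtype_comap (μ := MeasureTheory.volume)
    (s := Set.Icc (0 : ℝ) 1) measurableSet_Icc (fun x : ℝ => (x : ℂ) ^ k)
  have h2 : ∫ x in Set.Icc (0 : ℝ) 1, (x : ℂ) ^ k = 1 / ((k : ℂ) + 1) := by
    rw [MeasureTheory.integral_Icc_eq_integral_Ioc,
      ← intervalIntegral.integral_of_le zero_le_one]
    have := integral_pow (a := 0) (b := 1) k
    have h3 := intervalIntegral.integral_ofReal (a := 0) (b := 1)
      (μ := MeasureTheory.volume) (f := fun x : ℝ => x ^ k)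
    simp only [Complex.ofReal_pow] at h3
    rw [h3, this]
    simp
  rw [← h2, ← h]
  rfl

/-- A function homogeneous of degree `k` under the scaling is an eigenvector, with eigenvalue the
integral of `x ^ k` over `[0, 1]`. Iteration therefore creates the powers in the denominators of the
series. -/
theorem scalingAverage_pow_apply {X : Type*} [TopologicalSpace X] [CompactSpace X]
    [FirstCountableTopology X] [LocallyCompactSpace X]
    (m : C(I × X, X)) (φ : C(X, ℂ)) (k : ℕ)
    (hφ : ∀ x p, φ (m (x, p)) = ((x : ℝ) : ℂ) ^ k * φ p) (n : ℕ) :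
    (scalingAverage m ^ n) φ = (1 / ((k : ℂ) + 1)) ^ n • φ := by
  have h1 : scalingAverage m φ = (1 / ((k : ℂ) + 1)) • φ := by
    ext p
    simp only [scalingAverage_apply, hφ, ContinuousMap.smul_apply, smul_eq_mul]
    rw [MeasureTheory.integral_mul_const, integral_unitInterval_pow]
  induction n with
  | zero => simp
  | succ n ih =>
    rw [pow_succ', mul_apply_eq_comp, ih, map_smul, h1, smul_smul, pow_succ]

/-- The first coordinate function on the unit square. -/
noncomputable def coordFst : C(I × I, ℂ) := ⟨fun p => ((p.1 : ℝ) : ℂ), by fun_prop⟩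

/-- The second coordinate function on the unit square. -/
noncomputable def coordSnd : C(I × I, ℂ) := ⟨fun p => ((p.2 : ℝ) : ℂ), by fun_prop⟩

def scaleFst : C(I × (I × I), I × I) := ⟨fun q => (q.1 * q.2.1, q.2.2), by fun_prop⟩

def scaleSnd : C(I × (I × I), I × I) := ⟨fun q => (q.2.1, q.1 * q.2.2), by fun_prop⟩

/-- A continuous functional on `C([0, 1]², ℂ)` with
`s ^ i * t ^ j ↦ 1 / ((i + 1) ^ n₁ * (j + 1) ^ n₂)`. -/
noncomputable def zetaFunctional (n₁ n₂ : ℕ) : C(I × I, ℂ) →L[ℂ] ℂ :=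
  (ContinuousMap.evalCLM ℂ ((1, 1) : I × I)) ∘L (scalingAverage scaleSnd ^ n₂) ∘L
    (scalingAverage scaleFst ^ n₁)

theorem zetaFunctional_monomial (n₁ n₂ i j : ℕ) :
    zetaFunctional n₁ n₂ (coordFst ^ i * coordSnd ^ j) =
      1 / (((i : ℂ) + 1) ^ n₁ * ((j : ℂ) + 1) ^ n₂) := by
  have h1 := scalingAverage_pow_apply scaleFst (coordFst ^ i * coordSnd ^ j) i
    (fun x p => by simp [scaleFst, coordFst, coordSnd, mul_pow, mul_assoc]) n₁
  have h2 := scalingAverage_pow_apply scaleSnd (coordFst ^ i * coordSnd ^ j) j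
    (fun x p => by simp [scaleSnd, coordFst, coordSnd, mul_pow]; ring) n₂
  simp only [zetaFunctional, ContinuousLinearMap.comp_apply, h1, map_smul, h2]
  simp [coordFst, coordSnd, mul_comm]

theorem norm_coordFst_le : ‖coordFst‖ ≤ 1 :=
  (ContinuousMap.norm_le _ zero_le_one).2 fun p => by
    simpa [coordFst, abs_of_nonneg p.1.2.1] using p.1.2.2

theorem norm_coordSnd_le : ‖coordSnd‖ ≤ 1 :=
  (ContinuousMap.norm_le _ zero_le_one).2 fun p => by
    simpa [coordSnd, abs_of_nonneg p.2.2.1] using p.2.2.2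

/-! ### Analytic continuation by inverses in a Banach algebra -/

/-- The complex plane slit along `[1, ∞)`. -/
def slitOne : Set ℂ := {w | ∀ r : ℝ, 0 ≤ r → r ≤ 1 → 1 - w * r ≠ 0}

theorem mem_slitOne_of_notMem_nonnegRay {w : ℂ} (hw : w ∉ nonnegRay) : w ∈ slitOne := by
  intro r h0 h1 h
  have hr : r ≠ 0 := by rintro rfl; simp at h
  refine hw ⟨1 / r, by positivity, ?_⟩
  have : (r : ℂ) ≠ 0 := by exact_mod_cast hr
  push_cast
  field_simp
  linear_combination -h

theorem mul_mem_slitOne {w : ℂ} (hw : w ∈ slitOne) {r : ℝ} (h0 : 0 ≤ r) (h1 : r ≤ 1) :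
    w * r ∈ slitOne := by
  intro s hs0 hs1
  have := hw (r * s) (by positivity) (mul_le_one₀ h1 hs0 hs1)
  push_cast at this
  rwa [← mul_assoc] at this

/-- The continuation of the polylogarithm of depth one. -/
noncomputable def polyLiCont (m : ℕ) (z : Fin 1 → ℂ) : ℂ :=
  zetaFunctional m 0 (z 0 • Ring.inverse (1 - z 0 • coordFst))

/-- The continuation of the polylogarithm of depth two. -/
noncomputable def doubleLiCont (n₁ n₂ : ℕ) (z : Fin 2 → ℂ) : ℂ :=
  zetaFunctional n₁ n₂ ((z 0 * z 1 ^ 2) • (coordSnd *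
    (Ring.inverse (1 - (z 0 * z 1) • (coordFst * coordSnd)) *
      Ring.inverse (1 - z 1 • coordSnd))))

/-- The units of `C(I × I, ℂ)` are the nowhere vanishing functions, and inversion is analytic at
units. Analyticity of the continuations thus reduces to denominators having no zero on the square.
-/
theorem analyticAt_ringInverse_comp {E : Type*} [NormedAddCommGroup E] [NormedSpace ℂ E]
    {f : E → C(I × I, ℂ)} {x : E} (hf : AnalyticAt ℂ f x) (h : ∀ p, f x p ≠ 0) :
    AnalyticAt ℂ (fun y => Ring.inverse (f y)) x := by
  obtain ⟨u, hu⟩ := (ContinuousMap.isUnit_iff_forall_ne_zero (f x)).2 h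
  exact AnalyticAt.fun_comp (g := Ring.inverse) (hu ▸ analyticAt_inverse (𝕜 := ℂ) u) hf

theorem analyticAt_coord {d : ℕ} (i : Fin d) (z : Fin d → ℂ) :
    AnalyticAt ℂ (fun y : Fin d → ℂ => y i) z :=
  (ContinuousLinearMap.proj (R := ℂ) (φ := fun _ : Fin d => ℂ) i).analyticAt z

theorem polyLiCont_analyticAt (m : ℕ) {z : Fin 1 → ℂ} (hz : z 0 ∈ slitOne) :
    AnalyticAt ℂ (polyLiCont m) z := by
  have h0 := analyticAt_coord (0 : Fin 1) z
  refine ((zetaFunctional m 0).analyticAt _).fun_comp (h0.smul ?_)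
  refine analyticAt_ringInverse_comp (analyticAt_const.sub (h0.smul analyticAt_const)) fun p => ?_
  simpa [coordFst] using hz p.1 p.1.2.1 p.1.2.2

theorem doubleLiCont_analyticAt (n₁ n₂ : ℕ) {z : Fin 2 → ℂ} (h1 : z 1 ∈ slitOne)
    (h01 : z 0 * z 1 ∈ slitOne) : AnalyticAt ℂ (doubleLiCont n₁ n₂) z := by
  have a0 := analyticAt_coord (0 : Fin 2) z
  have a1 := analyticAt_coord (1 : Fin 2) z
  refine ((zetaFunctional n₁ n₂).analyticAt _).fun_comp ((a0.mul (a1.pow 2)).smul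
    (analyticAt_const.mul (AnalyticAt.mul ?_ ?_)))
  · refine analyticAt_ringInverse_comp
      (analyticAt_const.sub ((a0.mul a1).smul analyticAt_const)) fun p => ?_
    have := h01 (p.1 * p.2) (mul_nonneg p.1.2.1 p.2.2.1) (mul_le_one₀ p.1.2.2 p.2.2.1 p.2.2.2)
    simpa [coordFst, coordSnd] using this
  · refine analyticAt_ringInverse_comp
      (analyticAt_const.sub (a1.smul analyticAt_const)) fun p => ?_
    simpa [coordSnd] using h1 p.2 p.2.2.1 p.2.2.2

theorem polyLiCont_hasSum (m : ℕ) {z : Fin 1 → ℂ} (hz : ‖z 0‖ < 1) :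
    HasSum (fun i : ℕ => z 0 ^ (i + 1) / ((i : ℂ) + 1) ^ m) (polyLiCont m z) := by
  have hn : ‖z 0 • coordFst‖ < 1 := by
    rw [norm_smul]
    exact (mul_le_of_le_one_right (norm_nonneg _) norm_coordFst_le).trans_lt hz
  have h := ((hasSum_geom_series_inverse _ hn).const_smul (z 0)).mapL (zetaFunctional m 0)
  rw [polyLiCont]
  convert h using 2 with i
  have := zetaFunctional_monomial m 0 i 0
  simp only [pow_zero, mul_one] at this
  rw [map_smul, smul_pow, map_smul, this]
  simp only [smul_eq_mul]
  ring

/-- Both geometric series are expanded in the Banach algebra and the functional is applied termwise.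
The pair `p` encodes `k₁ = p.1 + 1` and `k₂ = p.1 + p.2 + 2`, which turns `0 < k₁ < k₂` into a free
choice in `ℕ × ℕ`. -/
theorem doubleLiCont_hasSum (n₁ n₂ : ℕ) {z : Fin 2 → ℂ} (h0 : ‖z 0‖ < 1) (h1 : ‖z 1‖ < 1) :
    HasSum (fun p : ℕ × ℕ => z 0 ^ (p.1 + 1) * z 1 ^ (p.1 + p.2 + 2) /
      (((p.1 : ℂ) + 1) ^ n₁ * ((p.1 : ℂ) + p.2 + 2) ^ n₂)) (doubleLiCont n₁ n₂ z) := by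
  have hn1 : ‖z 1 • coordSnd‖ < 1 := by
    rw [norm_smul]
    exact (mul_le_of_le_one_right (norm_nonneg _) norm_coordSnd_le).trans_lt h1
  have hn2 : ‖(z 0 * z 1) • (coordFst * coordSnd)‖ < 1 := by
    rw [norm_smul]
    refine (mul_le_of_le_one_right (norm_nonneg _) ((norm_mul_le _ _).trans
      (mul_le_one₀ norm_coordFst_le (norm_nonneg _) norm_coordSnd_le))).trans_lt ?_
    rw [norm_mul]
    exact mul_lt_one_of_nonneg_of_lt_one_left (norm_nonneg _) h0 h1.le
  have hs1 := summable_norm_geometric_of_norm_lt_one hn1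
  have hs2 := summable_norm_geometric_of_norm_lt_one hn2
  have hm := (hasSum_geom_series_inverse _ hn2).mul (hasSum_geom_series_inverse _ hn1)
    (summable_mul_of_summable_norm hs2 hs1)
  have h := ((hm.mul_left coordSnd).const_smul (z 0 * z 1 ^ 2)).mapL (zetaFunctional n₁ n₂)
  rw [doubleLiCont]
  convert h using 2 with p
  have := zetaFunctional_monomial n₁ n₂ p.1 (p.1 + p.2 + 1)
  have e : (z 0 * z 1 ^ 2) • (coordSnd * (((z 0 * z 1) • (coordFst * coordSnd)) ^ p.1 *
      (z 1 • coordSnd) ^ p.2)) = (z 0 ^ (p.1 + 1) * z 1 ^ (p.1 + p.2 + 2)) •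
      (coordFst ^ p.1 * coordSnd ^ (p.1 + p.2 + 1)) := by
    ext q
    simp
    ring
  rw [e, map_smul, this]
  push_cast
  rw [smul_eq_mul, mul_one_div]
  ring_nf

def finOneSeriesIndex : ℕ ≃ {k : Fin 1 → ℕ // StrictMono k ∧ ∀ i, 0 < k i} where
  toFun i := ⟨![i + 1], Subsingleton.strictMono _, by simp⟩
  invFun k := k.1 0 - 1
  left_inv i := by simp
  right_inv k := by
    have := k.2.2 0
    ext i
    fin_cases i
    simpa using Nat.sub_add_cancel this

def finTwoSeriesIndex : ℕ × ℕ ≃ {k : Fin 2 → ℕ // StrictMono k ∧ ∀ i, 0 < k i} where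
  toFun p := ⟨![p.1 + 1, p.1 + p.2 + 2], by
    rw [Fin.strictMono_iff_lt_succ]
    simp, by simp [Fin.forall_fin_two]⟩
  invFun k := (k.1 0 - 1, k.1 1 - k.1 0 - 1)
  left_inv p := by
    ext
    · simp
    · simp; omega
  right_inv k := by
    have h0 := k.2.2 0
    have h1 : k.1 0 < k.1 1 := k.2.1 (by simp)
    ext i
    fin_cases i
    · simp; omega
    · simp; omega

theorem polyLiCont_eq_mplSeries (m : ℕ) {z : Fin 1 → ℂ} (hz : ‖z 0‖ < 1) :
    polyLiCont m z = mplSeries ![m] z := by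
  rw [mplSeries, ← (polyLiCont_hasSum m hz).tsum_eq, ← finOneSeriesIndex.tsum_eq]
  simp [finOneSeriesIndex]

theorem doubleLiCont_eq_mplSeries (n₁ n₂ : ℕ) {z : Fin 2 → ℂ} (h0 : ‖z 0‖ < 1)
    (h1 : ‖z 1‖ < 1) : doubleLiCont n₁ n₂ z = mplSeries ![n₁, n₂] z := by
  rw [mplSeries, ← (doubleLiCont_hasSum n₁ n₂ h0 h1).tsum_eq, ← finTwoSeriesIndex.tsum_eq]
  refine tsum_congr fun p => ?_
  simp [finTwoSeriesIndex, Fin.prod_univ_two]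

theorem eventually_norm_coord_lt {d : ℕ} (i : Fin d) :
    ∀ᶠ z : Fin d → ℂ in 𝓝 0, ‖z i‖ < 1 :=
  (isOpen_lt (by fun_prop) continuous_const).mem_nhds (by simp)

/-- The star-shaped domain of the depth two polylogarithm. -/
def doubleLiDomain : Set (Fin 2 → ℂ) := {z | z 1 ∈ slitOne ∧ z 0 * z 1 ∈ slitOne}

theorem zero_mem_slitOne : (0 : ℂ) ∈ slitOne := fun r _ _ => by simp

theorem starConvex_doubleLiDomain : StarConvex ℝ 0 doubleLiDomain := by
  rw [starConvex_zero_iff]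
  intro z hz a h0 h1
  refine ⟨?_, ?_⟩
  · have := mul_mem_slitOne hz.1 h0 h1
    rwa [mul_comm] at this
  · have := mul_mem_slitOne hz.2 (mul_nonneg h0 h0) (mul_le_one₀ h1 h0 h1)
    convert this using 1
    simp
    ring

theorem starConvex_slitOne : StarConvex ℝ 0 slitOne := by
  rw [starConvex_zero_iff]
  intro z hz a h0 h1
  have := mul_mem_slitOne hz h0 h1
  rwa [mul_comm] at this

theorem isMPLContinuation_polyLiCont (m : ℕ) {z : ℂ} (hz : z ∈ slitOne) :
    IsMPLContinuation ![m] ![z] (polyLiCont m) := by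
  refine ⟨fun y hy => polyLiCont_analyticAt m ?_, ?_⟩
  · rw [segment_eq_image] at hy
    obtain ⟨t, ht, rfl⟩ := hy
    simpa using (starConvex_zero_iff.1 starConvex_slitOne) hz ht.1 ht.2
  · filter_upwards [eventually_norm_coord_lt (0 : Fin 1)] with y hy
    exact polyLiCont_eq_mplSeries m hy

theorem isMPLContinuation_doubleLiCont (n₁ n₂ : ℕ) {z : Fin 2 → ℂ} (hz : z ∈ doubleLiDomain) :
    IsMPLContinuation ![n₁, n₂] z (doubleLiCont n₁ n₂) := by
  refine ⟨fun y hy => ?_, ?_⟩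
  · rw [segment_eq_image] at hy
    obtain ⟨t, ht, rfl⟩ := hy
    have := (starConvex_zero_iff.1 starConvex_doubleLiDomain) hz ht.1 ht.2
    simp only [smul_zero, zero_add]
    exact doubleLiCont_analyticAt _ _ this.1 this.2
  · filter_upwards [eventually_norm_coord_lt (0 : Fin 2), eventually_norm_coord_lt (1 : Fin 2)]
      with y hy hy'
    exact doubleLiCont_eq_mplSeries _ _ hy hy'

theorem polyLi_eq (m : ℕ) {z : ℂ} (hz : z ∈ slitOne) : polyLi m z = polyLiCont m ![z] :=
  (isMPLContinuation_polyLiCont m hz).mpl_eq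

/-! ### Euler operators lower an index -/

theorem one_le_norm_succ_pow (k n : ℕ) : 1 ≤ ‖((k : ℂ) + 1) ^ n‖ := by
  rw [norm_pow]
  refine one_le_pow₀ ?_
  have : ‖(k : ℂ) + 1‖ = (k : ℝ) + 1 := by exact_mod_cast Complex.norm_natCast (k + 1)
  rw [this]
  simp

/-- If `f n z = ∑ a k * z ^ (d k + 1) / (d k + 1) ^ n` in the unit disc, then
`z * f (n + 1)' = f n`. -/
theorem mul_deriv_eq_of_hasSum_polylog {ι : Type*} {a : ι → ℂ} {d : ι → ℕ}
    (ha : ∀ r : ℝ, 0 < r → r < 1 → Summable fun k => ‖a k‖ * r ^ d k) {n : ℕ}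
    {f g : ℂ → ℂ}
    (hf : ∀ z, ‖z‖ < 1 → HasSum (fun k => a k * z ^ (d k + 1) / ((d k : ℂ) + 1) ^ (n + 1)) (f z))
    (hg : ∀ z, ‖z‖ < 1 → HasSum (fun k => a k * z ^ (d k + 1) / ((d k : ℂ) + 1) ^ n) (g z))
    {z f' : ℂ} (hz : ‖z‖ < 1) (hf' : HasDerivAt f f' z) : z * f' = g z := by
  obtain ⟨r, hzr, hr⟩ := exists_between hz
  have hr0 : 0 < r := (norm_nonneg z).trans_lt hzr
  have key := hasDerivAt_tsum_of_isPreconnected (𝕜 := ℂ) (u := fun k => ‖a k‖ * r ^ d k)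
    (t := Metric.ball (0 : ℂ) r)
    (g := fun k z => a k * z ^ (d k + 1) / ((d k : ℂ) + 1) ^ (n + 1))
    (g' := fun k z => a k * z ^ d k / ((d k : ℂ) + 1) ^ n) (ha r hr0 hr) Metric.isOpen_ball
    (convex_ball (0 : ℂ) r).isPreconnected ?_ ?_ (y₀ := z) (y := z) (by simpa using hzr)
    (hf z hz).summable (by simpa using hzr)
  · have h1 : HasDerivAt f (∑' k, a k * z ^ d k / ((d k : ℂ) + 1) ^ n) z := by
      refine key.congr_of_eventuallyEq ?_
      filter_upwards [Metric.isOpen_ball.mem_nhds (show z ∈ Metric.ball (0 : ℂ) 1 by simpa using hz)]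
        with y hy
      exact (hf y (by simpa using hy)).tsum_eq.symm
    rw [hf'.unique h1, ← tsum_mul_left, ← (hg z hz).tsum_eq]
    refine tsum_congr fun k => ?_
    ring
  · intro k y _
    have hk : (d k : ℂ) + 1 ≠ 0 := by exact_mod_cast (d k).succ_ne_zero
    refine (((hasDerivAt_pow (d k + 1) y).const_mul (a k)).div_const
      (((d k : ℂ) + 1) ^ (n + 1))).congr_deriv ?_
    push_cast
    field_simp
    ring
  · intro k y hy
    have hy' : ‖y‖ < r := by simpa using hy
    rw [norm_div, norm_mul, norm_pow]
    refine (div_le_self (by positivity) (one_le_norm_succ_pow _ _)).trans ?_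
    gcongr

theorem summable_norm_mul_pow_doubleLi_fst {w : ℂ} (hw : ‖w‖ < 1) (n : ℕ) {r : ℝ} (h0 : 0 < r)
    (h1 : r < 1) : Summable fun p : ℕ × ℕ =>
      ‖w ^ (p.1 + p.2 + 2) / ((p.1 : ℂ) + p.2 + 2) ^ n‖ * r ^ p.1 := by
  refine Summable.of_nonneg_of_le (fun p => by positivity) (fun p => ?_)
    ((summable_geometric_of_lt_one h0.le h1).mul_of_nonneg
      (summable_geometric_of_lt_one (norm_nonneg w) hw) (fun k => by positivity)
      (fun k => by positivity))
  have h := one_le_norm_succ_pow (p.1 + p.2 + 1) n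
  have e : ((p.1 : ℂ) + p.2 + 2) = ((p.1 + p.2 + 1 : ℕ) : ℂ) + 1 := by push_cast; ring
  rw [mul_comm, e, norm_div, norm_pow w]
  gcongr
  refine (div_le_self (by positivity) h).trans ?_
  exact pow_le_pow_of_le_one (norm_nonneg _) hw.le (by omega)

theorem summable_norm_mul_pow_doubleLi_snd {w : ℂ} (hw : ‖w‖ < 1) (n : ℕ) {r : ℝ} (h0 : 0 < r)
    (h1 : r < 1) : Summable fun p : ℕ × ℕ =>
      ‖w ^ (p.1 + 1) / ((p.1 : ℂ) + 1) ^ n‖ * r ^ (p.1 + p.2 + 1) := by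
  refine Summable.of_nonneg_of_le (fun p => by positivity) (fun p => ?_)
    ((summable_geometric_of_lt_one (norm_nonneg w) hw).mul_of_nonneg
      (summable_geometric_of_lt_one h0.le h1) (fun k => by positivity)
      (fun k => by positivity))
  have h := one_le_norm_succ_pow p.1 n
  rw [norm_div, norm_pow w]
  refine mul_le_mul ?_ ?_ (by positivity) (by positivity)
  · refine (div_le_self (by positivity) h).trans ?_
    exact pow_le_pow_of_le_one (norm_nonneg _) hw.le (by omega)
  · exact pow_le_pow_of_le_one h0.le h1.le (by omega)

theorem eqOn_of_starConvex_of_eventuallyEq {d : ℕ} {U : Set (Fin d → ℂ)} (hU : StarConvex ℝ 0 U)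
    (h0 : (0 : Fin d → ℂ) ∈ U) {f g : (Fin d → ℂ) → ℂ} (hf : AnalyticOnNhd ℂ f U)
    (hg : AnalyticOnNhd ℂ g U) (h : f =ᶠ[𝓝 0] g) : Set.EqOn f g U :=
  hf.eqOn_of_preconnected_of_eventuallyEq hg
    (hU.isPathConnected h0).isConnected.isPreconnected h0 h

theorem hasDerivAt_comp_update {d : ℕ} {f : (Fin d → ℂ) → ℂ} {z : Fin d → ℂ}
    (hf : AnalyticAt ℂ f z) (i : Fin d) :
    HasDerivAt (fun y => f (Function.update z i y)) (fderiv ℂ f z (Pi.single i 1)) (z i) := by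
  have h := hasDerivAt_update z i (z i)
  have hf' : HasFDerivAt f (fderiv ℂ f z) (Function.update z i (z i)) := by
    rw [Function.update_eq_self]
    exact hf.differentiableAt.hasFDerivAt
  exact hf'.comp_hasDerivAt (z i) h

theorem analyticOnNhd_euler {d : ℕ} {U : Set (Fin d → ℂ)} {f : (Fin d → ℂ) → ℂ}
    (hf : AnalyticOnNhd ℂ f U) (i : Fin d) :
    AnalyticOnNhd ℂ (fun z => z i * fderiv ℂ f z (Pi.single i 1)) U := fun z hz => by
  refine (analyticAt_coord i z).mul ?_
  exact ((ContinuousLinearMap.apply ℂ ℂ (Pi.single i (1 : ℂ) : Fin d → ℂ)).analyticAt _).fun_comp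
    (hf.fderiv z hz)

theorem doubleLiCont_analyticOnNhd (n₁ n₂ : ℕ) :
    AnalyticOnNhd ℂ (doubleLiCont n₁ n₂) doubleLiDomain :=
  fun _ hz => doubleLiCont_analyticAt n₁ n₂ hz.1 hz.2

/-- Both sides are analytic on a star-shaped domain, so it suffices to compare them near `0`, where
the series is differentiated term by term with the other variable absorbed into the coefficients. -/
theorem doubleLiCont_euler_fst (n₁ n₂ : ℕ) {z : Fin 2 → ℂ} (hz : z ∈ doubleLiDomain) :
    z 0 * fderiv ℂ (doubleLiCont (n₁ + 1) n₂) z (Pi.single 0 1) = doubleLiCont n₁ n₂ z := by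
  have h0 : (0 : Fin 2 → ℂ) ∈ doubleLiDomain := ⟨zero_mem_slitOne, by simpa using zero_mem_slitOne⟩
  refine eqOn_of_starConvex_of_eventuallyEq starConvex_doubleLiDomain h0
    (analyticOnNhd_euler (doubleLiCont_analyticOnNhd _ _) 0) (doubleLiCont_analyticOnNhd _ _) ?_ hz
  filter_upwards [eventually_norm_coord_lt (0 : Fin 2), eventually_norm_coord_lt (1 : Fin 2),
    (doubleLiCont_analyticAt (n₁ + 1) n₂ h0.1 h0.2).eventually_analyticAt] with y hy hy' hya
  have hd := hasDerivAt_comp_update hya 0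
  have := mul_deriv_eq_of_hasSum_polylog (d := fun p : ℕ × ℕ => p.1)
    (fun r => summable_norm_mul_pow_doubleLi_fst hy' n₂) (n := n₁)
    (g := fun x => doubleLiCont n₁ n₂ (Function.update y 0 x)) ?_ ?_ hy hd
  · simpa using this
  · intro x hx
    convert doubleLiCont_hasSum (n₁ + 1) n₂ (z := Function.update y 0 x) (by simpa) (by simpa)
      using 2 with p
    simp only [Function.update_self, ne_eq, one_ne_zero, not_false_eq_true,
      Function.update_of_ne, div_eq_mul_inv, mul_inv]
    ring
  · intro x hx
    convert doubleLiCont_hasSum n₁ n₂ (z := Function.update y 0 x) (by simpa) (by simpa)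
      using 2 with p
    simp only [Function.update_self, ne_eq, one_ne_zero, not_false_eq_true,
      Function.update_of_ne, div_eq_mul_inv, mul_inv]
    ring

theorem doubleLiCont_euler_snd (n₁ n₂ : ℕ) {z : Fin 2 → ℂ} (hz : z ∈ doubleLiDomain) :
    z 1 * fderiv ℂ (doubleLiCont n₁ (n₂ + 1)) z (Pi.single 1 1) = doubleLiCont n₁ n₂ z := by
  have h0 : (0 : Fin 2 → ℂ) ∈ doubleLiDomain := ⟨zero_mem_slitOne, by simpa using zero_mem_slitOne⟩
  refine eqOn_of_starConvex_of_eventuallyEq starConvex_doubleLiDomain h0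
    (analyticOnNhd_euler (doubleLiCont_analyticOnNhd _ _) 1) (doubleLiCont_analyticOnNhd _ _) ?_ hz
  filter_upwards [eventually_norm_coord_lt (0 : Fin 2), eventually_norm_coord_lt (1 : Fin 2),
    (doubleLiCont_analyticAt n₁ (n₂ + 1) h0.1 h0.2).eventually_analyticAt] with y hy hy' hya
  have hd := hasDerivAt_comp_update hya 1
  have := mul_deriv_eq_of_hasSum_polylog (d := fun p : ℕ × ℕ => p.1 + p.2 + 1)
    (fun r => summable_norm_mul_pow_doubleLi_snd hy n₁) (n := n₂)
    (g := fun x => doubleLiCont n₁ n₂ (Function.update y 1 x)) ?_ ?_ hy' hd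
  · simpa using this
  · intro x hx
    convert doubleLiCont_hasSum n₁ (n₂ + 1) (z := Function.update y 1 x) (by simpa) (by simpa)
      using 2 with p
    simp only [Function.update_self, ne_eq, zero_ne_one, not_false_eq_true,
      Function.update_of_ne, div_eq_mul_inv, mul_inv]
    push_cast
    ring
  · intro x hx
    convert doubleLiCont_hasSum n₁ n₂ (z := Function.update y 1 x) (by simpa) (by simpa)
      using 2 with p
    simp only [Function.update_self, ne_eq, zero_ne_one, not_false_eq_true,
      Function.update_of_ne, div_eq_mul_inv, mul_inv]
    push_cast
    ring

theorem polyLiCont_euler (m : ℕ) {z : Fin 1 → ℂ} (hz : z 0 ∈ slitOne) :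
    z 0 * fderiv ℂ (polyLiCont (m + 1)) z (Pi.single 0 1) = polyLiCont m z := by
  have hU : StarConvex ℝ 0 {z : Fin 1 → ℂ | z 0 ∈ slitOne} := by
    rw [starConvex_zero_iff]
    intro z hz a h0 h1
    exact (starConvex_zero_iff.1 starConvex_slitOne) hz h0 h1
  have hA : ∀ m, AnalyticOnNhd ℂ (polyLiCont m) {z : Fin 1 → ℂ | z 0 ∈ slitOne} :=
    fun m z hz => polyLiCont_analyticAt m hz
  refine eqOn_of_starConvex_of_eventuallyEq hU zero_mem_slitOne
    (analyticOnNhd_euler (hA _) 0) (hA _) ?_ hz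
  filter_upwards [eventually_norm_coord_lt (0 : Fin 1),
    (polyLiCont_analyticAt (m + 1) (z := 0) zero_mem_slitOne).eventually_analyticAt] with y hy hya
  have hd := hasDerivAt_comp_update hya 0
  have := mul_deriv_eq_of_hasSum_polylog (d := fun p : ℕ => p) (a := fun _ => 1)
    (fun r h0 h1 => by simpa using summable_geometric_of_lt_one h0.le h1) (n := m)
    (g := fun x => polyLiCont m (Function.update y 0 x)) ?_ ?_ hy hd
  · simpa using this
  · intro x hx
    simpa using polyLiCont_hasSum (m + 1) (z := Function.update y 0 x) (by simpa)
  · intro x hx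
    simpa using polyLiCont_hasSum m (z := Function.update y 0 x) (by simpa)

/-! ### One-variable derivatives off the ray -/

theorem isOpen_compl_nonnegRay : IsOpen nonnegRayᶜ := by
  have : nonnegRay = Complex.ofReal '' Set.Ici 0 := by
    ext w
    simp only [nonnegRay, Set.mem_ofPred_eq, Set.mem_image, Set.mem_Ici]
    exact exists_congr fun r => and_congr_right fun _ => eq_comm
  rw [this, isOpen_compl_iff]
  exact Complex.isometry_ofReal.isClosedEmbedding.isClosedMap _ isClosed_Ici

theorem ne_zero_of_notMem_nonnegRay {w : ℂ} (hw : w ∉ nonnegRay) : w ≠ 0 := by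
  rintro rfl
  exact hw ⟨0, le_rfl, by simp⟩

theorem one_div_notMem_nonnegRay {w : ℂ} (hw : w ∉ nonnegRay) : 1 / w ∉ nonnegRay := by
  rintro ⟨r, hr, h⟩
  refine hw ⟨1 / r, by positivity, ?_⟩
  push_cast
  rw [← h, one_div_one_div]

theorem neg_mem_slitPlane {w : ℂ} (hw : w ∉ nonnegRay) : -w ∈ Complex.slitPlane := by
  rw [Complex.mem_slitPlane_iff]
  by_contra! h
  refine hw ⟨w.re, by simpa using h.1, ?_⟩
  have := h.2
  exact Complex.ext (by simp) (by simpa using this)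

theorem mem_doubleLiDomain {z₁ z₂ : ℂ} (h₂ : z₂ ∉ nonnegRay) (h₁₂ : z₁ * z₂ ∉ nonnegRay) :
    ![z₁, z₂] ∈ doubleLiDomain :=
  ⟨mem_slitOne_of_notMem_nonnegRay h₂, by simpa using mem_slitOne_of_notMem_nonnegRay h₁₂⟩

theorem mem_doubleLiDomain_inv {z₁ z₂ : ℂ} (h₂ : z₂ ∉ nonnegRay) (h₁₂ : z₁ * z₂ ∉ nonnegRay) :
    ![1 / z₁, 1 / z₂] ∈ doubleLiDomain :=
  mem_doubleLiDomain (one_div_notMem_nonnegRay h₂) (by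
    rw [one_div_mul_one_div]
    exact one_div_notMem_nonnegRay h₁₂)

theorem update_fin_two_zero (z₁ z₂ y : ℂ) : Function.update ![z₁, z₂] 0 y = ![y, z₂] := by
  ext i; fin_cases i <;> simp

theorem update_fin_two_one (z₁ z₂ y : ℂ) : Function.update ![z₁, z₂] 1 y = ![z₁, y] := by
  ext i; fin_cases i <;> simp

theorem hasDerivAt_polyLiCont (m : ℕ) {z : ℂ} (hz : z ∉ nonnegRay) :
    HasDerivAt (fun y => polyLiCont (m + 1) ![y]) (polyLiCont m ![z] / z) z := by
  have hz' := mem_slitOne_of_notMem_nonnegRay hz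
  have h := hasDerivAt_comp_update (polyLiCont_analyticAt (m + 1) (z := ![z]) hz') 0
  have e := polyLiCont_euler m (z := ![z]) hz'
  have e2 : ∀ y, Function.update ![z] 0 y = ![y] := fun y => by
    ext i; fin_cases i; simp
  rw [← e]
  simp only [e2, Matrix.cons_val_zero] at h ⊢
  rwa [mul_div_cancel_left₀ _ (ne_zero_of_notMem_nonnegRay hz)]

theorem hasDerivAt_doubleLiCont_fst (n₁ n₂ : ℕ) {z₁ z₂ : ℂ} (h₁ : z₁ ≠ 0)
    (h : ![z₁, z₂] ∈ doubleLiDomain) :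
    HasDerivAt (fun y => doubleLiCont (n₁ + 1) n₂ ![y, z₂])
      (doubleLiCont n₁ n₂ ![z₁, z₂] / z₁) z₁ := by
  have hd := hasDerivAt_comp_update (doubleLiCont_analyticOnNhd (n₁ + 1) n₂ _ h) 0
  rw [← doubleLiCont_euler_fst n₁ n₂ h]
  simp only [update_fin_two_zero, Matrix.cons_val_zero] at hd ⊢
  rwa [mul_div_cancel_left₀ _ h₁]

theorem hasDerivAt_doubleLiCont_snd (n₁ n₂ : ℕ) {z₁ z₂ : ℂ} (h₂ : z₂ ≠ 0)
    (h : ![z₁, z₂] ∈ doubleLiDomain) :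
    HasDerivAt (fun y => doubleLiCont n₁ (n₂ + 1) ![z₁, y])
      (doubleLiCont n₁ n₂ ![z₁, z₂] / z₂) z₂ := by
  have hd := hasDerivAt_comp_update (doubleLiCont_analyticOnNhd n₁ (n₂ + 1) _ h) 1
  rw [← doubleLiCont_euler_snd n₁ n₂ h]
  simp only [update_fin_two_one, Matrix.cons_val_one, Matrix.cons_val_fin_one] at hd ⊢
  rwa [mul_div_cancel_left₀ _ h₂]

theorem berPoly_zero (w : ℂ) : berPoly 0 w = 1 := by
  simp [berPoly]

theorem hasDerivAt_berPoly_zero (w : ℂ) : HasDerivAt (berPoly 0) 0 w := by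
  rw [show berPoly 0 = fun _ => 1 from funext berPoly_zero]
  exact hasDerivAt_const _ _

/-- Since `B_{k+1}' = (k+1) B_k`, the normalisation `(2πi)^k / k!` absorbs both this factor and the
inner derivative, so `berPoly` behaves under the Euler operator like a polylogarithm. -/
theorem hasDerivAt_berPoly (k : ℕ) {w : ℂ} (hw : w ∉ nonnegRay) :
    HasDerivAt (berPoly (k + 1)) (berPoly k w / w) w := by
  have hw0 := ne_zero_of_notMem_nonnegRay hw
  have hlog : HasDerivAt (fun y : ℂ => 1 / 2 + Complex.log (-y) / (2 * (Real.pi : ℂ) * Complex.I))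
      (w⁻¹ / (2 * (Real.pi : ℂ) * Complex.I)) w := by
    refine HasDerivAt.const_add _ (HasDerivAt.div_const ?_ _)
    refine ((hasDerivAt_neg w).clog (neg_mem_slitPlane hw)).congr_deriv ?_
    field_simp
  have h := ((Polynomial.hasDerivAt_aeval (Polynomial.bernoulli (k + 1)) _).comp w hlog).const_mul
    ((2 * (Real.pi : ℂ) * Complex.I) ^ (k + 1) / ((k + 1).factorial : ℂ))
  refine h.congr_deriv ?_
  rw [Polynomial.derivative_bernoulli_add_one, berPoly]
  have hpi : (Real.pi : ℂ) ≠ 0 := by exact_mod_cast Real.pi_ne_zero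
  have hk : (k : ℂ) + 1 ≠ 0 := by exact_mod_cast k.succ_ne_zero
  simp only [map_mul, map_add, map_natCast, map_one, Nat.factorial_succ]
  push_cast
  field_simp
  ring

/-! ### Binomial convolutions and their derivatives -/

/-- `∑ (j choose c) * ℓ (j + 1) * b (N - j)`, over `0 ≤ j ≤ N`. -/
def chooseConv (c N : ℕ) (ℓ b : ℕ → ℂ) : ℂ :=
  ∑ j ∈ Finset.range (N + 1), (j.choose c : ℂ) * ℓ (j + 1) * b (N - j)

/-- Shifting the index in the first half leaves the coefficient `choose (j+1) (c+1) - choose j (c+1)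
= choose j c`. The boundary terms vanish because `choose 0 (c+1) = 0` and `b' 0 = 0`. -/
theorem chooseConv_pascal (c N : ℕ) (ℓ b b' : ℕ → ℂ) (h0 : b' 0 = 0)
    (h : ∀ m, b' (m + 1) = b m) :
    ∑ j ∈ Finset.range (N + 2), (j.choose (c + 1) : ℂ) *
      (-ℓ j * b (N + 1 - j) + ℓ (j + 1) * b' (N + 1 - j)) = -chooseConv c N ℓ b := by
  have h1 : ∑ j ∈ Finset.range (N + 2), (j.choose (c + 1) : ℂ) * (-ℓ j * b (N + 1 - j)) =
      ∑ j ∈ Finset.range (N + 1), ((j + 1).choose (c + 1) : ℂ) * (-ℓ (j + 1) * b (N - j)) := by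
    rw [Finset.sum_range_succ']
    simp
  have h2 : ∑ j ∈ Finset.range (N + 2), (j.choose (c + 1) : ℂ) * (ℓ (j + 1) * b' (N + 1 - j)) =
      ∑ j ∈ Finset.range (N + 1), (j.choose (c + 1) : ℂ) * (ℓ (j + 1) * b (N - j)) := by
    rw [Finset.sum_range_succ, Nat.sub_self, h0]
    simp only [mul_zero, add_zero]
    refine Finset.sum_congr rfl fun j hj => ?_
    rw [Nat.succ_sub (Nat.lt_succ_iff.1 (Finset.mem_range.1 hj)), h]
  simp only [mul_add]
  rw [Finset.sum_add_distrib, h1, h2, ← Finset.sum_add_distrib, chooseConv,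
    ← Finset.sum_neg_distrib]
  refine Finset.sum_congr rfl fun j _ => ?_
  rw [Nat.choose_succ_succ]
  push_cast
  ring

theorem chooseConv_shift (c N : ℕ) (ℓ b b' : ℕ → ℂ) (h0 : b' 0 = 0) (h : ∀ m, b' (m + 1) = b m) :
    chooseConv c (N + 1) ℓ b' = chooseConv c N ℓ b := by
  rw [chooseConv, Finset.sum_range_succ, Nat.sub_self, h0, mul_zero, add_zero, chooseConv]
  refine Finset.sum_congr rfl fun j hj => ?_
  rw [Nat.succ_sub (Nat.lt_succ_iff.1 (Finset.mem_range.1 hj)), h]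

/-- The case where both factors depend on the variable: the product rule and Pascal's rule lower `c`
and `N` together. The minus sign in the hypothesis on `ℓ` fits both `(-1)^m Li_m(z)` and
`Li_m(1/z)`. -/
theorem hasDerivAt_chooseConv_left (c N : ℕ) {ℓ b : ℕ → ℂ → ℂ} {z : ℂ}
    (hℓ : ∀ m, HasDerivAt (ℓ (m + 1)) (-ℓ m z / z) z)
    (hb0 : HasDerivAt (b 0) 0 z) (hb : ∀ m, HasDerivAt (b (m + 1)) (b m z / z) z) :
    HasDerivAt (fun y => chooseConv (c + 1) (N + 1) (fun m => ℓ m y) (fun m => b m y))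
      (-chooseConv c N (fun m => ℓ m z) (fun m => b m z) / z) z := by
  -- The Euler derivatives of the sequence `b`: a shift, with value `0` at the constant term `b 0`.
  let b' : ℕ → ℂ := fun m => Nat.casesOn m 0 fun m => b m z
  have hb' : ∀ m, HasDerivAt (b m) (b' m / z) z := by
    rintro (_ | m)
    · simpa [b'] using hb0
    · exact hb m
  rw [← chooseConv_pascal c N (fun m => ℓ m z) (fun m => b m z) b' rfl fun m => rfl]
  unfold chooseConv
  refine (HasDerivAt.fun_sum fun j _ =>
    ((hℓ j).const_mul (j.choose (c + 1) : ℂ)).mul (hb' (N + 1 - j))).congr_deriv ?_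
  rw [Finset.sum_div]
  refine Finset.sum_congr rfl fun j _ => ?_
  ring

theorem hasDerivAt_chooseConv_right (c N : ℕ) {ℓ : ℕ → ℂ} {b : ℕ → ℂ → ℂ} {z : ℂ}
    (hb0 : HasDerivAt (b 0) 0 z) (hb : ∀ m, HasDerivAt (b (m + 1)) (b m z / z) z) :
    HasDerivAt (fun y => chooseConv c (N + 1) ℓ (fun m => b m y))
      (chooseConv c N ℓ (fun m => b m z) / z) z := by
  let b' : ℕ → ℂ := fun m => Nat.casesOn m 0 fun m => b m z
  have hb' : ∀ m, HasDerivAt (b m) (b' m / z) z := by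
    rintro (_ | m)
    · simpa [b'] using hb0
    · exact hb m
  rw [← chooseConv_shift c N ℓ (fun m => b m z) b' rfl fun m => rfl]
  unfold chooseConv
  refine (HasDerivAt.fun_sum fun j _ =>
    (hb' (N + 1 - j)).const_mul ((j.choose c : ℂ) * ℓ (j + 1))).congr_deriv ?_
  rw [Finset.sum_div]
  refine Finset.sum_congr rfl fun j _ => ?_
  ring

/-! ### The defect of the parity formula and its descent in the indices -/

/-- The difference of the two sides of the depth two parity formula, of index
`(a + 1, b + 1)`. -/
noncomputable def parityDefect (a b : ℕ) (z₁ z₂ : ℂ) : ℂ :=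
  doubleLiCont (a + 1) (b + 1) ![z₁, z₂]
    - (-1) ^ (a + b) * doubleLiCont (a + 1) (b + 1) ![1 / z₁, 1 / z₂]
    + (-1) ^ a * chooseConv a (a + b + 1) (fun m => (-1) ^ m * polyLiCont m ![z₁])
        (fun m => berPoly m (z₁ * z₂))
    + polyLiCont (a + b + 2) ![z₁ * z₂]
    + (-1) ^ b * chooseConv b (a + b + 1) (fun m => polyLiCont m ![1 / z₂])
        (fun m => berPoly m (z₁ * z₂))
    + polyLiCont (a + 1) ![z₁] * berPoly (b + 1) z₂

theorem hasDerivAt_comp_mul_right {f : ℂ → ℂ} {c z w : ℂ} (h : HasDerivAt f (c / (z * w)) (z * w))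
    (hw : w ≠ 0) : HasDerivAt (fun y => f (y * w)) (c / z) z := by
  refine (h.comp z ((hasDerivAt_id z).mul_const w)).congr_deriv ?_
  field_simp

theorem hasDerivAt_comp_one_div {f : ℂ → ℂ} {c z : ℂ} (h : HasDerivAt f (c / (1 / z)) (1 / z))
    (hz : z ≠ 0) : HasDerivAt (fun y => f (1 / y)) (-c / z) z := by
  simp only [one_div] at h ⊢
  refine (h.comp z (hasDerivAt_inv hz)).congr_deriv ?_
  field_simp

/-- Each summand drops one index under `z₁ ∂/∂z₁`. Inverting the argument gives a minus sign, and so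
does the binomial sum in `z₁`; these match the changes of `(-1)^(a+b)` and `(-1)^a`. -/
theorem hasDerivAt_parityDefect_fst (a b : ℕ) {z₁ z₂ : ℂ} (h₁ : z₁ ∉ nonnegRay)
    (h₂ : z₂ ∉ nonnegRay) (h₁₂ : z₁ * z₂ ∉ nonnegRay) :
    HasDerivAt (fun y => parityDefect (a + 1) b y z₂) (parityDefect a b z₁ z₂ / z₁) z₁ := by
  have n₁ := ne_zero_of_notMem_nonnegRay h₁
  have n₂ := ne_zero_of_notMem_nonnegRay h₂
  have d1 := hasDerivAt_doubleLiCont_fst (a + 1) (b + 1) n₁ (mem_doubleLiDomain h₂ h₁₂)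
  have d2 := hasDerivAt_comp_one_div (hasDerivAt_doubleLiCont_fst (a + 1) (b + 1)
    (one_div_ne_zero n₁) (mem_doubleLiDomain_inv h₂ h₁₂)) n₁
  have hb0 : HasDerivAt (fun y => berPoly 0 (y * z₂)) 0 z₁ := by
    simpa using hasDerivAt_comp_mul_right (c := 0) (by simpa using hasDerivAt_berPoly_zero _) n₂
  have hb : ∀ m, HasDerivAt (fun y => berPoly (m + 1) (y * z₂)) (berPoly m (z₁ * z₂) / z₁) z₁ :=
    fun m => hasDerivAt_comp_mul_right (hasDerivAt_berPoly m h₁₂) n₂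
  have d3 := hasDerivAt_chooseConv_left a (a + b + 1)
    (ℓ := fun m y => (-1) ^ m * polyLiCont m ![y]) (b := fun m y => berPoly m (y * z₂))
    (fun m => ((hasDerivAt_polyLiCont m h₁).const_mul ((-1) ^ (m + 1))).congr_deriv (by ring))
    hb0 hb
  have d4 := hasDerivAt_comp_mul_right (hasDerivAt_polyLiCont (a + b + 2) h₁₂) n₂
  have d5 := hasDerivAt_chooseConv_right b (a + b + 1) (ℓ := fun m => polyLiCont m ![1 / z₂])
    (b := fun m y => berPoly m (y * z₂)) hb0 hb
  have d6 := hasDerivAt_polyLiCont (a + 1) h₁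
  have key := ((((d1.sub (d2.const_mul ((-1) ^ (a + 1 + b)))).add
    (d3.const_mul ((-1) ^ (a + 1)))).add d4).add (d5.const_mul ((-1) ^ b))).add
    (d6.mul_const (berPoly (b + 1) z₂))
  have e1 : a + 1 + b + 1 = a + b + 1 + 1 := by ring
  have e2 : a + 1 + b + 2 = a + b + 2 + 1 := by ring
  unfold parityDefect
  rw [e1, e2]
  refine key.congr_deriv ?_
  ring

theorem hasDerivAt_parityDefect_snd (a b : ℕ) {z₁ z₂ : ℂ} (h₁ : z₁ ∉ nonnegRay)
    (h₂ : z₂ ∉ nonnegRay) (h₁₂ : z₁ * z₂ ∉ nonnegRay) :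
    HasDerivAt (fun y => parityDefect a (b + 1) z₁ y) (parityDefect a b z₁ z₂ / z₂) z₂ := by
  have n₁ := ne_zero_of_notMem_nonnegRay h₁
  have n₂ := ne_zero_of_notMem_nonnegRay h₂
  have d1 := hasDerivAt_doubleLiCont_snd (a + 1) (b + 1) n₂ (mem_doubleLiDomain h₂ h₁₂)
  have d2 := hasDerivAt_comp_one_div (hasDerivAt_doubleLiCont_snd (a + 1) (b + 1)
    (one_div_ne_zero n₂) (mem_doubleLiDomain_inv h₂ h₁₂)) n₂
  rw [mul_comm] at h₁₂
  have hb0 : HasDerivAt (fun y => berPoly 0 (z₁ * y)) 0 z₂ := by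
    simp only [mul_comm z₁]
    simpa using hasDerivAt_comp_mul_right (c := 0) (by simpa using hasDerivAt_berPoly_zero _) n₁
  have hb : ∀ m, HasDerivAt (fun y => berPoly (m + 1) (z₁ * y)) (berPoly m (z₁ * z₂) / z₂) z₂ :=
    fun m => by
      simp only [mul_comm z₁]
      exact hasDerivAt_comp_mul_right (hasDerivAt_berPoly m h₁₂) n₁
  have d3 := hasDerivAt_chooseConv_left b (a + b + 1)
    (ℓ := fun m y => polyLiCont m ![1 / y]) (b := fun m y => berPoly m (z₁ * y))
    (fun m => hasDerivAt_comp_one_div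
      (hasDerivAt_polyLiCont m (one_div_notMem_nonnegRay h₂)) n₂) hb0 hb
  have d4 := hasDerivAt_comp_mul_right (hasDerivAt_polyLiCont (a + b + 2) h₁₂) n₁
  have d5 := hasDerivAt_chooseConv_right a (a + b + 1)
    (ℓ := fun m => (-1) ^ m * polyLiCont m ![z₁]) (b := fun m y => berPoly m (z₁ * y)) hb0 hb
  have d6 := hasDerivAt_berPoly (b + 1) h₂
  simp only [mul_comm _ z₁] at d4
  have key := ((((d1.sub (d2.const_mul ((-1) ^ (a + (b + 1))))).add
    (d5.const_mul ((-1) ^ a))).add d4).add (d3.const_mul ((-1) ^ (b + 1)))).add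
    (d6.const_mul (polyLiCont (a + 1) ![z₁]))
  unfold parityDefect
  refine key.congr_deriv ?_
  ring

/-- The domain is open, so the defect of higher index vanishes near `z₁` and so does its derivative.
-/
theorem parityDefect_eq_zero_of_succ_fst {a b : ℕ}
    (h : ∀ z₁ z₂, z₁ ∉ nonnegRay → z₂ ∉ nonnegRay → z₁ * z₂ ∉ nonnegRay →
      parityDefect (a + 1) b z₁ z₂ = 0) {z₁ z₂ : ℂ} (h₁ : z₁ ∉ nonnegRay)
    (h₂ : z₂ ∉ nonnegRay) (h₁₂ : z₁ * z₂ ∉ nonnegRay) : parityDefect a b z₁ z₂ = 0 := by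
  have hd := hasDerivAt_parityDefect_fst a b h₁ h₂ h₁₂
  have hc : (fun y => parityDefect (a + 1) b y z₂) =ᶠ[𝓝 z₁] fun _ => 0 := by
    filter_upwards [isOpen_compl_nonnegRay.mem_nhds h₁,
      (isOpen_compl_nonnegRay.preimage (continuous_mul_const z₂)).mem_nhds h₁₂] with y hy hy'
    exact h y z₂ hy h₂ hy'
  have := (hasDerivAt_const z₁ (0 : ℂ)).congr_of_eventuallyEq hc |>.unique hd
  simpa [ne_zero_of_notMem_nonnegRay h₁] using this.symm

theorem parityDefect_eq_zero_of_succ_snd {a b : ℕ}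
    (h : ∀ z₁ z₂, z₁ ∉ nonnegRay → z₂ ∉ nonnegRay → z₁ * z₂ ∉ nonnegRay →
      parityDefect a (b + 1) z₁ z₂ = 0) {z₁ z₂ : ℂ} (h₁ : z₁ ∉ nonnegRay)
    (h₂ : z₂ ∉ nonnegRay) (h₁₂ : z₁ * z₂ ∉ nonnegRay) : parityDefect a b z₁ z₂ = 0 := by
  have hd := hasDerivAt_parityDefect_snd a b h₁ h₂ h₁₂
  have hc : (fun y => parityDefect a (b + 1) z₁ y) =ᶠ[𝓝 z₂] fun _ => 0 := by
    filter_upwards [isOpen_compl_nonnegRay.mem_nhds h₂,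
      (isOpen_compl_nonnegRay.preimage (continuous_const_mul z₁)).mem_nhds h₁₂] with y hy hy'
    exact h z₁ y h₁ hy hy'
  have := (hasDerivAt_const z₂ (0 : ℂ)).congr_of_eventuallyEq hc |>.unique hd
  simpa [ne_zero_of_notMem_nonnegRay h₂] using this.symm

/-! ### From the torus to the whole domain -/

theorem mul_notMem_nonnegRay {w : ℂ} (hw : w ∉ nonnegRay) {r : ℝ} (hr : 0 < r) :
    (r : ℂ) * w ∉ nonnegRay := by
  rintro ⟨s, hs, h⟩
  refine hw ⟨s / r, by positivity, ?_⟩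
  have : (r : ℂ) ≠ 0 := by exact_mod_cast hr.ne'
  push_cast
  rw [← h]
  field_simp

/-- A function that is holomorphic where `z` and `c * z` avoid `[0, ∞)` and vanishes there on the
unit circle is zero. -/
theorem eq_zero_of_eq_zero_on_circle (c : ℂ) {g : ℂ → ℂ}
    (hg : ∀ z, z ∉ nonnegRay → c * z ∉ nonnegRay → DifferentiableAt ℂ g z)
    (h0 : ∀ z, z ∉ nonnegRay → c * z ∉ nonnegRay → ‖z‖ = 1 → g z = 0)
    {z : ℂ} (hz : z ∉ nonnegRay) (hcz : c * z ∉ nonnegRay) : g z = 0 := by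
  set W : Set ℂ := {z | z ∉ nonnegRay ∧ c * z ∉ nonnegRay} with hW
  have hWo : IsOpen W :=
    isOpen_compl_nonnegRay.inter (isOpen_compl_nonnegRay.preimage (continuous_const_mul c))
  have hscale : ∀ {z : ℂ} {r : ℝ}, 0 < r → z ∈ W → (r : ℂ) * z ∈ W := fun {z r} hr hz =>
    ⟨mul_notMem_nonnegRay hz.1 hr, by
      rw [mul_left_comm]
      exact mul_notMem_nonnegRay hz.2 hr⟩
  have hexp : ∀ ζ : ℂ, Complex.exp (ζ * Complex.I) =
      (Real.exp (-ζ.im) : ℂ) * Complex.exp (ζ.re * Complex.I) := fun ζ => by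
    rw [Complex.ofReal_exp, ← Complex.exp_add]
    congr 1
    conv_lhs => rw [← Complex.re_add_im ζ]
    push_cast
    linear_combination (ζ.im : ℂ) * Complex.I_sq
  obtain ⟨ζ, rfl⟩ : ∃ ζ, Complex.exp (ζ * Complex.I) = z :=
    ⟨-Complex.I * Complex.log z, by
      rw [show -Complex.I * Complex.log z * Complex.I = Complex.log z by
        linear_combination -Complex.log z * Complex.I_sq]
      exact Complex.exp_log (ne_zero_of_notMem_nonnegRay hz)⟩
  have hre : Complex.exp (ζ.re * Complex.I) ∈ W := by
    have h := hscale (Real.exp_pos ζ.im) (show _ ∈ W from ⟨hz, hcz⟩)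
    rw [hexp, ← mul_assoc, ← Complex.ofReal_mul, ← Real.exp_add] at h
    simpa using h
  have hcont : Continuous fun t : ℝ => Complex.exp (t * Complex.I) := by fun_prop
  obtain ⟨ε, hε, hball⟩ := Metric.isOpen_iff.1 (hWo.preimage hcont) ζ.re hre
  -- In the coordinate `z = exp(iξ)` radial scaling is vertical translation, so an arc of the circle
  -- inside `W` yields a whole vertical strip mapped into `W`. The strip is connected, and its real
  -- points correspond to the unit circle.
  set V : Set ℂ := Complex.re ⁻¹' Metric.ball ζ.re ε with hV
  have hVW : ∀ ξ ∈ V, Complex.exp (ξ * Complex.I) ∈ W := fun ξ hξ => by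
    rw [hexp]
    exact hscale (Real.exp_pos _) (hball hξ)
  have hVo : IsOpen V := Metric.isOpen_ball.preimage Complex.continuous_re
  have hVc : Convex ℝ V := (convex_ball ζ.re ε).linear_preimage Complex.reLm
  have hana : AnalyticOnNhd ℂ (fun ξ => g (Complex.exp (ξ * Complex.I))) V := by
    refine DifferentiableOn.analyticOnNhd (fun ξ hξ => ?_) hVo
    have := hg _ (hVW ξ hξ).1 (hVW ξ hξ).2
    exact (DifferentiableAt.fun_comp' ξ this (by fun_prop)).differentiableWithinAt
  have hmem : ((ζ.re : ℝ) : ℂ) ∈ V := by simpa [hV] using hε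
  have hfreq : ∃ᶠ ξ in 𝓝[≠] ((ζ.re : ℝ) : ℂ), g (Complex.exp (ξ * Complex.I)) = 0 := by
    have ht : Tendsto Complex.ofReal (𝓝[≠] ζ.re) (𝓝[≠] ((ζ.re : ℝ) : ℂ)) :=
      Complex.continuous_ofReal.continuousWithinAt.tendsto_nhdsWithin
        fun t ht h => ht (Complex.ofReal_injective h)
    refine ht.frequently (Eventually.frequently ?_)
    filter_upwards [nhdsWithin_le_nhds (Metric.ball_mem_nhds ζ.re hε)] with t ht
    exact h0 _ (hball ht).1 (hball ht).2 (Complex.norm_exp_ofReal_mul_I t)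
  exact hana.eqOn_zero_of_preconnected_of_frequently_eq_zero hVc.isPreconnected hmem hfreq
    (show ζ ∈ V by simpa [hV] using hε)

/-- One variable is freed at a time: for `y` on the circle the second variable leaves the circle,
and then `y` itself does. The successor indices provide differentiability. -/
theorem parityDefect_eq_zero_of_torus {a b : ℕ}
    (h : ∀ z₁ z₂, ‖z₁‖ = 1 → ‖z₂‖ = 1 → z₁ ∉ nonnegRay → z₂ ∉ nonnegRay →
      z₁ * z₂ ∉ nonnegRay → parityDefect (a + 1) (b + 1) z₁ z₂ = 0)
    {z₁ z₂ : ℂ} (h₁ : z₁ ∉ nonnegRay) (h₂ : z₂ ∉ nonnegRay) (h₁₂ : z₁ * z₂ ∉ nonnegRay) :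
    parityDefect (a + 1) (b + 1) z₁ z₂ = 0 := by
  refine eq_zero_of_eq_zero_on_circle z₂ (g := fun y => parityDefect (a + 1) (b + 1) y z₂)
    (fun y hy hy' => (hasDerivAt_parityDefect_fst a (b + 1) hy h₂
      (by rwa [mul_comm])).differentiableAt) (fun y hy hy' hy1 => ?_) h₁ (by rwa [mul_comm])
  refine eq_zero_of_eq_zero_on_circle y (g := fun u => parityDefect (a + 1) (b + 1) y u)
    (fun u hu hu' => (hasDerivAt_parityDefect_snd (a + 1) b hy hu hu').differentiableAt)
    (fun u hu hu' hu1 => h y u hy1 hu1 hy hu hu') h₂ (by rwa [mul_comm])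

/-! ### Fourier series of Bernoulli polynomials on the unit circle -/

theorem HasSum.of_eq {ι : Type*} {f g : ι → ℂ} {a b : ℂ} (h : HasSum f a) (hf : ∀ i, g i = f i)
    (ha : b = a) : HasSum g b := by
  rw [ha, funext hf]
  exact h

/-- The argument of `B_k` in `berPoly` is the angle of `w` in full turns, taken in `[0, 1]`, where
the Fourier expansion of the Bernoulli polynomials holds. -/
theorem exists_eq_exp_of_norm_one {w : ℂ} (hw : w ∉ nonnegRay) (h1 : ‖w‖ = 1) :
    ∃ x : ℝ, x ∈ Set.Icc (0 : ℝ) 1 ∧ w = Complex.exp (2 * Real.pi * Complex.I * x) ∧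
      1 / 2 + Complex.log (-w) / (2 * (Real.pi : ℂ) * Complex.I) = x := by
  have hpi : (Real.pi : ℂ) ≠ 0 := by exact_mod_cast Real.pi_ne_zero
  have hlog : Complex.log (-w) = (-w).arg * Complex.I := by
    rw [Complex.log, norm_neg, h1]
    simp
  have hx : 1 / 2 + Complex.log (-w) / (2 * (Real.pi : ℂ) * Complex.I) =
      ((1 / 2 + (-w).arg / (2 * Real.pi) : ℝ) : ℂ) := by
    rw [hlog]
    push_cast
    field_simp
  refine ⟨1 / 2 + (-w).arg / (2 * Real.pi), ⟨?_, ?_⟩, ?_, hx⟩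
  · have := Complex.neg_pi_lt_arg (-w)
    have hp := Real.pi_pos
    rw [← sub_nonneg, show (1 / 2 + (-w).arg / (2 * Real.pi) - 0 : ℝ) =
      (Real.pi + (-w).arg) / (2 * Real.pi) by field_simp; ring]
    exact div_nonneg (by linarith) (by positivity)
  · have := Complex.arg_le_pi (-w)
    have hp := Real.pi_pos
    rw [← sub_nonneg, show (1 - (1 / 2 + (-w).arg / (2 * Real.pi)) : ℝ) =
      (Real.pi - (-w).arg) / (2 * Real.pi) by field_simp; ring]
    exact div_nonneg (by linarith) (by positivity)
  · rw [← hx, show 2 * (Real.pi : ℂ) * Complex.I *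
      (1 / 2 + Complex.log (-w) / (2 * (Real.pi : ℂ) * Complex.I)) =
      Real.pi * Complex.I + Complex.log (-w) by field_simp, Complex.exp_add, Complex.exp_pi_mul_I,
      Complex.exp_log (neg_ne_zero.2 (ne_zero_of_notMem_nonnegRay hw))]
    ring

theorem hasSum_zpow_div_pow {k : ℕ} (hk : 2 ≤ k) {w : ℂ} (hw : w ∉ nonnegRay) (h1 : ‖w‖ = 1) :
    HasSum (fun n : ℤ => w ^ n * (1 / (n : ℂ) ^ k)) (-berPoly k w) := by
  obtain ⟨x, hx, hwx, hlog⟩ := exists_eq_exp_of_norm_one hw h1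
  refine (hasSum_one_div_pow_mul_fourier_mul_bernoulliFun hk hx).of_eq (fun n => ?_) ?_
  · rw [mul_comm, fourier_coe_apply, hwx, ← Complex.exp_int_mul]
    congr 2
    push_cast
    ring
  · rw [berPoly, hlog, bernoulliFun]
    simp only [neg_div, neg_mul]
    congr 2
    rw [Polynomial.eval_map, ← Polynomial.aeval_def]
    exact Polynomial.aeval_algebraMap_apply ℂ x (Polynomial.bernoulli k)

theorem summable_one_div_int_sq_shift (l : ℤ) :
    Summable fun n : ℤ => (1 : ℝ) / ((n - l : ℤ) : ℝ) ^ 2 :=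
  (Equiv.subRight l).summable_iff (f := fun n : ℤ => (1 : ℝ) / (n : ℝ) ^ 2) |>.2 (Real.summable_one_div_int_pow.2 (by norm_num : 1 < 2))

theorem norm_one_div_sub_one_div_le (n : ℤ) :
    ‖(1 : ℂ) / n - 1 / ((n : ℂ) - 1)‖ ≤ 1 / (n : ℝ) ^ 2 + 1 / ((n - 1 : ℤ) : ℝ) ^ 2 := by
  rcases eq_or_ne n 0 with rfl | h0
  · simp
  rcases eq_or_ne n 1 with rfl | h1
  · simp
  have h0' : (n : ℝ) ≠ 0 := by exact_mod_cast h0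
  have h1' : ((n - 1 : ℤ) : ℝ) ≠ 0 := by exact_mod_cast sub_ne_zero.2 h1
  have e : (1 : ℂ) / n - 1 / ((n : ℂ) - 1) =
      ((1 / (n : ℝ) - 1 / ((n - 1 : ℤ) : ℝ) : ℝ) : ℂ) := by push_cast; ring
  have e2 : 1 / (n : ℝ) - 1 / ((n - 1 : ℤ) : ℝ) = -(1 / (n : ℝ) * (1 / ((n - 1 : ℤ) : ℝ))) := by
    field_simp
    push_cast
    ring
  -- With `x = 1/n` and `y = 1/(n-1)` the difference is `-xy`, and `|xy| ≤ x² + y²`.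
  rw [e, Complex.norm_real, Real.norm_eq_abs, e2, ← one_div_pow, ← one_div_pow]
  rw [abs_le]
  constructor <;> nlinarith [sq_nonneg (1 / (n : ℝ) - 1 / ((n - 1 : ℤ) : ℝ)),
    sq_nonneg (1 / (n : ℝ) + 1 / ((n - 1 : ℤ) : ℝ)), sq_nonneg (1 / (n : ℝ)),
    sq_nonneg (1 / ((n - 1 : ℤ) : ℝ))]

theorem hasSum_comp_sub {w a : ℂ} (hw : w ≠ 0) {f : ℤ → ℂ} (l : ℕ)
    (h : HasSum (fun n : ℤ => w ^ n * f n) a) :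
    HasSum (fun n : ℤ => w ^ n * f (n - l)) (w ^ l * a) := by
  have := ((Equiv.subRight (l : ℤ)).hasSum_iff.2 h).mul_left (w ^ l)
  refine this.of_eq (fun n => ?_) rfl
  rw [Function.comp, Equiv.subRight_apply, ← mul_assoc]
  rw [zpow_sub₀ hw, zpow_natCast, mul_div_cancel₀]
  exact pow_ne_zero l hw

theorem int_mul_one_div_sq_sub (n : ℤ) :
    (n : ℂ) * (1 / (n : ℂ) ^ 2 - 1 / ((n : ℂ) - 1) ^ 2) =
      1 / n - 1 / ((n : ℂ) - 1) - 1 / ((n : ℂ) - 1) ^ 2 := by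
  rcases eq_or_ne n 0 with rfl | h0
  · simp
  rcases eq_or_ne n 1 with rfl | h1
  · simp
  have h0' : (n : ℂ) ≠ 0 := by exact_mod_cast h0
  have h1' : (n : ℂ) - 1 ≠ 0 := sub_ne_zero.2 (by exact_mod_cast h1)
  field_simp
  ring

/-- The series `∑ w^n / n` does not converge absolutely, but its difference with a shift does. The
value comes from differentiating the shifted difference of the `k = 2` series termwise along the
circle, since each derivative brings down a factor `n`. -/
theorem hasSum_zpow_mul_one_div_sub_one {w : ℂ} (hw : w ∉ nonnegRay) (h1 : ‖w‖ = 1) :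
    HasSum (fun n : ℤ => w ^ n * (1 / (n : ℂ) - 1 / ((n : ℂ) - 1))) (-((1 - w) * berPoly 1 w)) := by
  have hsq : ∀ v : ℂ, v ∉ nonnegRay → ‖v‖ = 1 →
      HasSum (fun n : ℤ => v ^ n * (1 / ((n : ℂ) - 1) ^ 2)) (-(v * berPoly 2 v)) := fun v hv hv1 => by
    simpa using hasSum_comp_sub (ne_zero_of_notMem_nonnegRay hv) 1 (hasSum_zpow_div_pow le_rfl hv hv1)
  have hw0 := ne_zero_of_notMem_nonnegRay hw
  obtain ⟨x, -, hwx, -⟩ := exists_eq_exp_of_norm_one hw h1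
  obtain ⟨t₀, ht₀⟩ : ∃ t : ℝ, w = Complex.exp (t * Complex.I) :=
    ⟨2 * Real.pi * x, by rw [hwx]; push_cast; ring_nf⟩
  set e : ℝ → ℂ := fun t => Complex.exp (t * Complex.I) with he
  have he0 : ∀ t, e t ≠ 0 := fun t => Complex.exp_ne_zero _
  have he1 : ∀ t, ‖e t‖ = 1 := fun t => Complex.norm_exp_ofReal_mul_I t
  have hed : ∀ t, HasDerivAt e (Complex.I * e t) t := fun t => by
    have := ((hasDerivAt_id t).ofReal_comp.mul_const Complex.I).cexp
    refine this.congr_deriv ?_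
    simp [he]
    ring
  set u : ℤ → ℝ := fun n => 1 / (n : ℝ) ^ 2 + 1 / ((n - 1 : ℤ) : ℝ) ^ 2 + 1 / ((n - 1 : ℤ) : ℝ) ^ 2
  have hu : Summable u :=
    ((Real.summable_one_div_int_pow.2 (by norm_num : 1 < 2)).add
      (summable_one_div_int_sq_shift 1)).add (summable_one_div_int_sq_shift 1)
  set A : ℤ → ℂ := fun n => 1 / (n : ℂ) ^ 2 - 1 / ((n : ℂ) - 1) ^ 2
  have hbound : ∀ n : ℤ, ‖(n : ℂ) * A n‖ ≤ u n := fun n => by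
    rw [int_mul_one_div_sq_sub]
    refine (norm_sub_le _ _).trans (add_le_add (norm_one_div_sub_one_div_le n) (le_of_eq ?_))
    rw [norm_div, norm_pow, norm_one, ← sq_abs ((n - 1 : ℤ) : ℝ)]
    congr 2
    rw [← Complex.norm_intCast]
    push_cast
    rfl
  have hA : ∀ v : ℂ, v ∉ nonnegRay → ‖v‖ = 1 →
      HasSum (fun n : ℤ => v ^ n * A n) (-((1 - v) * berPoly 2 v)) := fun v hv hv1 => by
    exact ((hasSum_zpow_div_pow le_rfl hv hv1).sub (hsq v hv hv1)).of_eq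
      (fun n => mul_sub _ _ _) (by ring)
  have hder := hasDerivAt_tsum (𝕜 := ℝ) (u := u) (g := fun (n : ℤ) t => e t ^ n * A n)
    (g' := fun n t => Complex.I * (e t ^ n * ((n : ℂ) * A n))) hu
    (fun n t => by
      refine ((((hasDerivAt_zpow n (e t) (Or.inl (he0 t))).comp t (hed t))).mul_const
        (A n)).congr_deriv ?_
      rw [zpow_sub_one₀ (he0 t)]
      field_simp [he0 t])
    (fun n t => by
      rw [norm_mul, norm_mul, norm_zpow, he1, Complex.norm_I, one_zpow, one_mul, one_mul]
      exact hbound n) (y₀ := t₀)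
    (by have := (hA w hw h1).summable; rwa [ht₀] at this) t₀
  have hne : ∀ᶠ t in 𝓝 t₀, e t ∉ nonnegRay :=
    (isOpen_compl_nonnegRay.preimage (by fun_prop : Continuous e)).mem_nhds
      (by simpa [he, ← ht₀] using hw)
  have hwe : e t₀ = w := ht₀.symm
  have hder2 : HasDerivAt (fun t => -((1 - e t) * berPoly 2 (e t)))
      (-(-(Complex.I * w) * berPoly 2 w + (1 - w) * (Complex.I * berPoly 1 w))) t₀ := by
    have hb : HasDerivAt (fun t => berPoly 2 (e t)) (Complex.I * berPoly 1 w) t₀ := by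
      refine ((hwe.symm ▸ hasDerivAt_berPoly 1 hw : HasDerivAt (berPoly 2)
        (berPoly 1 w / w) (e t₀)).comp t₀ (hed t₀)).congr_deriv ?_
      rw [hwe]
      field_simp
    have h := (((hed t₀).const_sub 1).mul hb).neg
    rwa [hwe] at h
  have huniq := hder.unique (hder2.congr_of_eventuallyEq (by
    filter_upwards [hne] with t ht
    exact (hA (e t) ht (he1 t)).tsum_eq))
  rw [tsum_mul_left, hwe] at huniq
  have hsum : HasSum (fun n : ℤ => w ^ n * ((n : ℂ) * A n))
      (w * berPoly 2 w - (1 - w) * berPoly 1 w) := by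
    have hs : Summable fun n : ℤ => w ^ n * ((n : ℂ) * A n) :=
      Summable.of_norm_bounded hu fun n => by
        rw [norm_mul, norm_zpow, h1, one_zpow, one_mul]
        exact hbound n
    refine hs.hasSum.of_eq (fun n => rfl) (mul_left_cancel₀ Complex.I_ne_zero ?_)
    rw [huniq]
    ring
  refine (hsum.add (hsq w hw h1)).of_eq (fun n => ?_) ?_
  · rw [int_mul_one_div_sq_sub]
    ring
  · ring

theorem hasSum_zpow_mul_one_div_sub {w : ℂ} (hw : w ∉ nonnegRay) (h1 : ‖w‖ = 1) (l : ℕ) :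
    HasSum (fun n : ℤ => w ^ n * (1 / (n : ℂ) - 1 / ((n : ℂ) - l)))
      (-((1 - w ^ l) * berPoly 1 w)) := by
  induction l with
  | zero => simp
  | succ l ih =>
    have h := hasSum_comp_sub (f := fun n : ℤ => 1 / (n : ℂ) - 1 / ((n : ℂ) - 1))
      (ne_zero_of_notMem_nonnegRay hw) l (hasSum_zpow_mul_one_div_sub_one hw h1)
    refine (ih.add h).of_eq (fun n => ?_) ?_
    · push_cast
      rw [sub_sub]
      ring
    · ring

/-! ### Partial fractions -/

/-- With geometric `ℓ`, Pascal's rule becomes the recursion that `1/(n(n-l)) = (1/l)(1/(n-l) - 1/n)`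
imposes on the partial fraction sums. -/
theorem chooseConv_pow_succ (c N : ℕ) (x : ℂ) (b : ℕ → ℂ) :
    chooseConv (c + 1) (N + 1) (fun m => x ^ m) b =
      x * (chooseConv (c + 1) N (fun m => x ^ m) b + chooseConv c N (fun m => x ^ m) b) := by
  simp only [chooseConv]
  rw [Finset.sum_range_succ', ← Finset.sum_add_distrib, Finset.mul_sum]
  simp only [Nat.choose_zero_succ, Nat.cast_zero, zero_mul, add_zero]
  refine Finset.sum_congr rfl fun j _ => ?_
  rw [Nat.choose_succ_succ, Nat.add_sub_add_right]
  push_cast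
  ring

theorem chooseConv_zero_pow_succ (N : ℕ) (x : ℂ) (b : ℕ → ℂ) :
    chooseConv 0 (N + 1) (fun m => x ^ m) b =
      x * (b (N + 1) + chooseConv 0 N (fun m => x ^ m) b) := by
  simp only [chooseConv]
  rw [Finset.sum_range_succ', mul_add, Finset.mul_sum, add_comm]
  congr 1
  · simp
  refine Finset.sum_congr rfl fun j _ => ?_
  rw [Nat.add_sub_add_right, Nat.choose_zero_right, Nat.choose_zero_right]
  ring

theorem chooseConv_self_pow (c : ℕ) (x : ℂ) (b : ℕ → ℂ) :
    chooseConv c c (fun m => x ^ m) b = x ^ (c + 1) * b 0 := by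
  rw [chooseConv, Finset.sum_eq_single_of_mem c (by simp)]
  · simp
  · intro j hj hjc
    have : j < c := by have := Finset.mem_range.1 hj; omega
    simp [Nat.choose_eq_zero_of_lt this]

/-- The value of `∑ n : ℤ, w ^ n / (n ^ (p + 1) * (n - l) ^ (q + 1))`, with `x = 1 / l`. -/
noncomputable def partialFractionSum (w : ℂ) (l p q : ℕ) : ℂ :=
  (-1) ^ q * chooseConv q (p + q + 1) (fun m => (1 / (l : ℂ)) ^ m) (fun m => berPoly m w) +
    (-1) ^ p * w ^ l *
      chooseConv p (p + q + 1) (fun m => (-(1 / (l : ℂ))) ^ m) (fun m => berPoly m w)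

theorem hasSum_zpow_partialFraction {w : ℂ} (hw : w ∉ nonnegRay) (h1 : ‖w‖ = 1) {l : ℕ}
    (hl : 0 < l) (p q : ℕ) :
    HasSum (fun n : ℤ => w ^ n * (1 / (n : ℂ) ^ (p + 1) * (1 / ((n : ℂ) - l) ^ (q + 1))))
      (partialFractionSum w l p q) := by
  have hl' : (l : ℂ) ≠ 0 := by exact_mod_cast hl.ne'
  have hw0 := ne_zero_of_notMem_nonnegRay hw
  have hpure : ∀ k, 2 ≤ k → HasSum (fun n : ℤ => w ^ n * (1 / (n : ℂ) ^ k)) (-berPoly k w) :=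
    fun k hk => hasSum_zpow_div_pow hk hw h1
  have hpure' : ∀ k, 2 ≤ k →
      HasSum (fun n : ℤ => w ^ n * (1 / ((n : ℂ) - l) ^ k)) (-(w ^ l * berPoly k w)) :=
    fun k hk => (hasSum_comp_sub hw0 l (hpure k hk)).of_eq (fun n => by simp) (by ring)
  -- As `1/0 = 0`, the summand is zero at `n = 0` and `n = l`, while the partial fraction identity
  -- can fail there. These point masses repair it, and they account for the `berPoly 0` terms of the
  -- closed form.
  have hpt : ∀ c : ℂ, HasSum (fun n : ℤ => if n = 0 then c else 0) c := fun c => hasSum_ite_eq 0 c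
  have hpt' : ∀ c : ℂ, HasSum (fun n : ℤ => if n = l then c else 0) c :=
    fun c => hasSum_ite_eq (l : ℤ) c
  have hl0 : (l : ℤ) ≠ 0 := by exact_mod_cast hl.ne'
  have hne : ∀ n : ℤ, n ≠ 0 → n ≠ l → (n : ℂ) ≠ 0 ∧ (n : ℂ) - l ≠ 0 := fun n h h' =>
    ⟨by exact_mod_cast h, sub_ne_zero.2 (by exact_mod_cast h')⟩
  induction p generalizing q with
  | zero =>
    induction q with
    | zero =>
      refine ((((hasSum_zpow_mul_one_div_sub hw h1 l).mul_left (-(1 / (l : ℂ)))).add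
        (hpt ((1 / (l : ℂ)) ^ 2))).add (hpt' ((1 / (l : ℂ)) ^ 2 * w ^ l))).of_eq (fun n => ?_) ?_
      · rcases eq_or_ne n 0 with rfl | h0
        · simp [hl0.symm]
          ring
        rcases eq_or_ne n l with rfl | hn
        · simp [hl.ne']
          ring
        obtain ⟨a, b⟩ := hne n h0 hn
        simp only [h0, hn, if_false]
        field_simp
        ring
      · rw [partialFractionSum]
        simp only [pow_zero, one_mul, zero_add, chooseConv_zero_pow_succ, chooseConv_self_pow,
          berPoly_zero]
        ring
    | succ q ih =>
      refine (((((hpure' (q + 2) (by omega))).sub ih).mul_left (1 / (l : ℂ))).sub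
        (hpt (1 / (l : ℂ) * (-(1 / (l : ℂ))) ^ (q + 2)))).of_eq (fun n => ?_) ?_
      · rcases eq_or_ne n 0 with rfl | h0
        · have e : (-(l : ℂ)⁻¹) ^ (q + 2) = ((-(l : ℂ)) ^ (q + 2))⁻¹ := by rw [← inv_neg, inv_pow]
          simp [e]
        rcases eq_or_ne n l with rfl | hn
        · simp [hl.ne']
        obtain ⟨a, b⟩ := hne n h0 hn
        simp only [h0, if_false]
        field_simp
        ring
      · rw [partialFractionSum, partialFractionSum, ← add_assoc, chooseConv_pow_succ,
          chooseConv_zero_pow_succ, zero_add, chooseConv_self_pow, berPoly_zero]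
        ring
  | succ p ih =>
    induction q with
    | zero =>
      refine ((((ih 0).sub (hpure (p + 2) (by omega))).mul_left (1 / (l : ℂ))).add
        (hpt' ((1 / (l : ℂ)) ^ (p + 3) * w ^ l))).of_eq (fun n => ?_) ?_
      · rcases eq_or_ne n 0 with rfl | h0
        · simp [hl0.symm]
        rcases eq_or_ne n l with rfl | hn
        · simp
          ring
        obtain ⟨a, b⟩ := hne n h0 hn
        simp only [hn, if_false]
        field_simp
        ring
      · rw [partialFractionSum, partialFractionSum, show p + 1 + 0 + 1 = p + 1 + 1 from rfl,
          chooseConv_pow_succ, chooseConv_zero_pow_succ, add_zero, chooseConv_self_pow,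
          berPoly_zero]
        have e : (-1 : ℂ) ^ p * (-1) ^ p = 1 := by rw [← mul_pow]; simp
        linear_combination (1 / (l : ℂ)) ^ (p + 3) * w ^ l * e
    | succ q ihq =>
      -- Here every term contains both `1/n` and `1/(n-l)`, so both sides vanish at the exceptional
      -- points and no correction is needed.
      refine (((ih (q + 1)).sub ihq).mul_left (1 / (l : ℂ))).of_eq (fun n => ?_) ?_
      · rcases eq_or_ne n 0 with rfl | h0
        · simp
        rcases eq_or_ne n l with rfl | hn
        · simp
        obtain ⟨a, b⟩ := hne n h0 hn
        field_simp
        ring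
      · rw [partialFractionSum, partialFractionSum, partialFractionSum,
          show p + 1 + (q + 1) + 1 = p + q + 2 + 1 by ring, show p + (q + 1) + 1 = p + q + 2 by ring,
          show p + 1 + q + 1 = p + q + 2 by ring, chooseConv_pow_succ q (p + q + 2),
          chooseConv_pow_succ p (p + q + 2)]
        ring

/-! ### Radial limits: the series on the unit circle -/

/-- Dominated convergence as `r → 1` from below identifies the sum at the boundary with the value of
the continuation. -/
theorem hasSum_of_hasSum_radial {ι : Type*} {f : ι → ℝ → ℂ} {u : ι → ℝ} {F : ℝ → ℂ}
    (hu : Summable u) (hfu : ∀ k r, 0 ≤ r → r ≤ 1 → ‖f k r‖ ≤ u k) (hf : ∀ k, Continuous (f k))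
    (hF : ∀ r, 0 ≤ r → r < 1 → HasSum (fun k => f k r) (F r)) (hFc : ContinuousAt F 1) :
    HasSum (fun k => f k 1) (F 1) := by
  have hs : Summable fun k => f k 1 :=
    Summable.of_norm_bounded hu fun k => hfu k 1 zero_le_one le_rfl
  have hev : ∀ᶠ r : ℝ in 𝓝[<] 1, 0 ≤ r ∧ r < 1 := by
    filter_upwards [Ioo_mem_nhdsLT (zero_lt_one' ℝ)] with r hr using ⟨hr.1.le, hr.2⟩
  have h1 : Tendsto (fun r => ∑' k, f k r) (𝓝[<] 1) (𝓝 (∑' k, f k 1)) :=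
    tendsto_tsum_of_dominated_convergence hu
      (fun k => ((hf k).tendsto 1).mono_left nhdsWithin_le_nhds)
      (hev.mono fun r hr k => hfu k r hr.1 hr.2.le)
  have h2 : Tendsto (fun r => ∑' k, f k r) (𝓝[<] 1) (𝓝 (F 1)) := by
    refine (hFc.tendsto.mono_left nhdsWithin_le_nhds).congr' ?_
    exact hev.mono fun r hr => (hF r hr.1 hr.2).tsum_eq.symm
  rw [← tendsto_nhds_unique h1 h2]
  exact hs.hasSum

theorem summable_one_div_succ_sq : Summable fun i : ℕ => 1 / ((i : ℝ) + 1) ^ 2 := by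
  have := (summable_nat_add_iff 1).2 (Real.summable_one_div_nat_pow.2 (by norm_num : 1 < 2))
  simpa using this

theorem norm_succ_pow (i m : ℕ) : ‖((i : ℂ) + 1) ^ m‖ = ((i : ℝ) + 1) ^ m := by
  rw [norm_pow]
  congr 1
  exact_mod_cast Complex.norm_natCast (i + 1)

theorem hasSum_polyLiCont_circle {m : ℕ} (hm : 2 ≤ m) {z : ℂ} (hz : z ∉ nonnegRay)
    (h1 : ‖z‖ = 1) :
    HasSum (fun i : ℕ => z ^ (i + 1) * (1 / ((i : ℂ) + 1) ^ m)) (polyLiCont m ![z]) := by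
  have hc : ContinuousAt (fun r : ℝ => polyLiCont m ![r * z]) 1 := by
    have h := (polyLiCont_analyticAt m (z := ![((1 : ℝ) : ℂ) * z])
      (by simpa using mem_slitOne_of_notMem_nonnegRay hz)).continuousAt
    exact ContinuousAt.comp (f := fun r : ℝ => ![(r : ℂ) * z]) h (by fun_prop)
  have := hasSum_of_hasSum_radial (f := fun (i : ℕ) r => (r * z) ^ (i + 1) / ((i : ℂ) + 1) ^ m)
    summable_one_div_succ_sq (fun i r h0 hr => ?_) (fun i => by fun_prop) (fun r h0 hr => ?_) hc
  · simpa [div_eq_mul_inv] using this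
  · rw [norm_div, norm_pow, norm_mul, h1, norm_succ_pow, mul_one, Complex.norm_real,
      Real.norm_of_nonneg h0]
    exact div_le_div₀ zero_le_one (pow_le_one₀ h0 hr) (by positivity)
      (pow_le_pow_right₀ (by simp) hm)
  · exact polyLiCont_hasSum m (z := ![r * z]) (by simpa [h1, abs_of_nonneg h0] using hr)

theorem hasSum_doubleLiCont_circle {n₁ n₂ : ℕ} (hn₁ : 2 ≤ n₁) (hn₂ : 2 ≤ n₂) {z₁ z₂ : ℂ}
    (h₁ : ‖z₁‖ = 1) (h₂ : ‖z₂‖ = 1) (hz : ![z₁, z₂] ∈ doubleLiDomain) :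
    HasSum (fun p : ℕ × ℕ => z₁ ^ (p.1 + 1) * z₂ ^ (p.1 + p.2 + 2) /
      (((p.1 : ℂ) + 1) ^ n₁ * ((p.1 : ℂ) + p.2 + 2) ^ n₂)) (doubleLiCont n₁ n₂ ![z₁, z₂]) := by
  have hc : ContinuousAt (fun r : ℝ => doubleLiCont n₁ n₂ ![r * z₁, r * z₂]) 1 := by
    have h := (doubleLiCont_analyticOnNhd n₁ n₂ ![((1 : ℝ) : ℂ) * z₁, ((1 : ℝ) : ℂ) * z₂]
      (by simpa using hz)).continuousAt
    exact ContinuousAt.comp (f := fun r : ℝ => ![(r : ℂ) * z₁, (r : ℂ) * z₂]) h (by fun_prop)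
  have := hasSum_of_hasSum_radial
    (f := fun (p : ℕ × ℕ) r => (r * z₁) ^ (p.1 + 1) * (r * z₂) ^ (p.1 + p.2 + 2) /
      (((p.1 : ℂ) + 1) ^ n₁ * ((p.1 : ℂ) + p.2 + 2) ^ n₂))
    (summable_one_div_succ_sq.mul_of_nonneg summable_one_div_succ_sq (fun i => by positivity)
      (fun i => by positivity)) (fun p r h0 hr => ?_) (fun i => by fun_prop)
    (fun r h0 hr => ?_) hc
  · simpa using this
  · have e : ((p.1 : ℂ) + p.2 + 2) = ((p.1 + p.2 + 1 : ℕ) : ℂ) + 1 := by push_cast; ring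
    rw [e, norm_div, norm_mul, norm_mul, norm_pow, norm_pow, norm_mul, norm_mul, h₁, h₂,
      norm_succ_pow, norm_succ_pow, mul_one, Complex.norm_real, Real.norm_of_nonneg h0,
      div_mul_div_comm, one_mul]
    refine div_le_div₀ zero_le_one (mul_le_one₀ (pow_le_one₀ h0 hr) (by positivity)
      (pow_le_one₀ h0 hr)) (by positivity) (mul_le_mul (pow_le_pow_right₀ (by simp) hn₁) ?_
      (by positivity) (by positivity))
    refine (pow_le_pow_left₀ (by positivity) ?_ 2).trans (pow_le_pow_right₀ (by simp; positivity) hn₂)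
    push_cast
    have : (0 : ℝ) ≤ p.1 := by positivity
    linarith
  · exact doubleLiCont_hasSum n₁ n₂ (z := ![r * z₁, r * z₂])
      (by simpa [h₁, abs_of_nonneg h0] using hr) (by simpa [h₂, abs_of_nonneg h0] using hr)

/-! ### The double series over `ℤ × ℤ`, region by region -/

/-- The terms of the double series, on all of `ℤ × ℤ`; they vanish on the axes. -/
noncomputable def doubleLiTerm (n₁ n₂ : ℕ) (z₁ z₂ : ℂ) (p : ℤ × ℤ) : ℂ :=
  z₁ ^ p.1 * (1 / (p.1 : ℂ) ^ n₁) * (z₂ ^ p.2 * (1 / (p.2 : ℂ) ^ n₂))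

theorem hasSum_ite_of_injective {ι κ : Type*} {g : ι → κ} (hg : Function.Injective g)
    {P : κ → Prop} [DecidablePred P] (hP : ∀ k, P k ↔ k ∈ Set.range g) {f : κ → ℂ} {a : ℂ}
    (h : HasSum (fun i => f (g i)) a) : HasSum (fun k => if P k then f k else 0) a := by
  refine (hg.hasSum_iff fun k hk => if_neg (mt (hP k).1 hk)).1 (h.of_eq (fun i => ?_) rfl)
  exact if_pos ((hP _).2 ⟨i, rfl⟩)

/-- The binomial coefficients kill all indices `m ≤ c`. With `c ≥ 1` only `Li_m` with `m ≥ 2` is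
summed, so absolute convergence on the circle suffices. -/
theorem hasSum_chooseConv {ι : Type*} (c N : ℕ) {ℓ : ι → ℕ → ℂ} {L b : ℕ → ℂ}
    (h : ∀ m, c < m → HasSum (fun i => ℓ i m) (L m)) :
    HasSum (fun i => chooseConv c N (ℓ i) b) (chooseConv c N L b) := by
  refine hasSum_sum fun j _ => ?_
  rcases lt_or_ge j c with hj | hj
  · simp [Nat.choose_eq_zero_of_lt hj]
  · exact ((h (j + 1) (by omega)).mul_left _).mul_right _

theorem summable_doubleLiTerm {a b : ℕ} (ha : 1 ≤ a) (hb : 1 ≤ b) {z₁ z₂ : ℂ} (u₁ : ‖z₁‖ = 1)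
    (u₂ : ‖z₂‖ = 1) (h₁ : z₁ ∉ nonnegRay) (h₂ : z₂ ∉ nonnegRay) :
    Summable (doubleLiTerm (a + 1) (b + 1) z₁ z₂) :=
  summable_mul_of_summable_norm (f := fun n : ℤ => z₁ ^ n * (1 / (n : ℂ) ^ (a + 1)))
    (g := fun n : ℤ => z₂ ^ n * (1 / (n : ℂ) ^ (b + 1)))
    (hasSum_zpow_div_pow (show 2 ≤ a + 1 by omega) h₁ u₁).summable.norm
    (hasSum_zpow_div_pow (show 2 ≤ b + 1 by omega) h₂ u₂).summable.norm

theorem hasSum_doubleLiTerm_lt {a b : ℕ} (ha : 1 ≤ a) (hb : 1 ≤ b) {z₁ z₂ : ℂ} (u₁ : ‖z₁‖ = 1)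
    (u₂ : ‖z₂‖ = 1) (h₂ : z₂ ∉ nonnegRay) (h₁₂ : z₁ * z₂ ∉ nonnegRay) :
    HasSum (fun p : ℤ × ℤ => if 0 < p.1 ∧ p.1 < p.2 then doubleLiTerm (a + 1) (b + 1) z₁ z₂ p else 0)
      (doubleLiCont (a + 1) (b + 1) ![z₁, z₂]) := by
  refine hasSum_ite_of_injective (g := fun p : ℕ × ℕ => ((p.1 : ℤ) + 1, (p.1 : ℤ) + p.2 + 2))
    (fun p q h => ?_) (fun p => ⟨fun h => ?_, ?_⟩)
    ((hasSum_doubleLiCont_circle (show 2 ≤ a + 1 by omega) (show 2 ≤ b + 1 by omega) u₁ u₂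
      (mem_doubleLiDomain h₂ h₁₂)).of_eq (fun p => ?_) rfl)
  · simp only [Prod.mk.injEq] at h
    ext <;> omega
  · exact ⟨((p.1 - 1).toNat, (p.2 - p.1 - 1).toNat), by ext <;> simp <;> omega⟩
  · rintro ⟨q, rfl⟩
    simp only
    omega
  · simp only [doubleLiTerm]
    rw [show (p.1 : ℤ) + p.2 + 2 = ((p.1 + p.2 + 2 : ℕ) : ℤ) by push_cast; ring,
      show (p.1 : ℤ) + 1 = ((p.1 + 1 : ℕ) : ℤ) by push_cast; ring, zpow_natCast, zpow_natCast]
    push_cast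
    simp only [div_eq_mul_inv, mul_inv]
    ring

/-- The reflection `(k₁, k₂) ↦ (-k₁, -k₂)` inverts the variables and produces the sign
`(-1)^((a+1)+(b+1))`. -/
theorem hasSum_doubleLiTerm_neg {a b : ℕ} (ha : 1 ≤ a) (hb : 1 ≤ b) {z₁ z₂ : ℂ} (u₁ : ‖z₁‖ = 1)
    (u₂ : ‖z₂‖ = 1) (h₂ : z₂ ∉ nonnegRay) (h₁₂ : z₁ * z₂ ∉ nonnegRay) :
    HasSum (fun p : ℤ × ℤ => if p.1 < 0 ∧ p.2 < p.1 then doubleLiTerm (a + 1) (b + 1) z₁ z₂ p else 0)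
      ((-1) ^ (a + b) * doubleLiCont (a + 1) (b + 1) ![1 / z₁, 1 / z₂]) := by
  have v₁ : ‖1 / z₁‖ = 1 := by rw [norm_div, u₁, norm_one, div_one]
  have v₂ : ‖1 / z₂‖ = 1 := by rw [norm_div, u₂, norm_one, div_one]
  refine hasSum_ite_of_injective
    (g := fun p : ℕ × ℕ => (-((p.1 : ℤ) + 1), -((p.1 : ℤ) + p.2 + 2)))
    (fun p q h => ?_) (fun p => ⟨fun h => ?_, ?_⟩)
    (((hasSum_doubleLiCont_circle (show 2 ≤ a + 1 by omega) (show 2 ≤ b + 1 by omega) v₁ v₂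
      (mem_doubleLiDomain_inv h₂ h₁₂)).mul_left ((-1) ^ (a + b))).of_eq (fun p => ?_) rfl)
  · simp only [Prod.mk.injEq] at h
    ext <;> omega
  · exact ⟨((-p.1 - 1).toNat, (p.1 - p.2 - 1).toNat), by ext <;> simp <;> omega⟩
  · rintro ⟨q, rfl⟩
    simp only
    omega
  · simp only [doubleLiTerm]
    rw [show (p.1 : ℤ) + p.2 + 2 = ((p.1 + p.2 + 2 : ℕ) : ℤ) by push_cast; ring,
      show (p.1 : ℤ) + 1 = ((p.1 + 1 : ℕ) : ℤ) by push_cast; ring, zpow_neg, zpow_neg,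
      zpow_natCast, zpow_natCast]
    push_cast
    rw [neg_pow, neg_pow ((p.1 : ℂ) + p.2 + 2)]
    have e : ∀ n : ℕ, ((-1 : ℂ) ^ n)⁻¹ = (-1) ^ n := fun n => by rw [← inv_pow]; norm_num
    simp only [div_eq_mul_inv, mul_inv, one_mul, inv_pow, e]
    ring

theorem hasSum_doubleLiTerm_pos {a b : ℕ} (ha : 1 ≤ a) (hb : 1 ≤ b) {z₁ z₂ : ℂ} (u₁ : ‖z₁‖ = 1)
    (u₂ : ‖z₂‖ = 1) (h₁ : z₁ ∉ nonnegRay) (h₂ : z₂ ∉ nonnegRay) :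
    HasSum (fun p : ℤ × ℤ => if 0 < p.1 then doubleLiTerm (a + 1) (b + 1) z₁ z₂ p else 0)
      (polyLiCont (a + 1) ![z₁] * -berPoly (b + 1) z₂) := by
  have hs₂ := hasSum_zpow_div_pow (show 2 ≤ b + 1 by omega) h₂ u₂
  have hl₁ := hasSum_polyLiCont_circle (show 2 ≤ a + 1 by omega) h₁ u₁
  refine hasSum_ite_of_injective (g := fun p : ℕ × ℤ => ((p.1 : ℤ) + 1, p.2))
    (fun p q h => ?_) (fun p => ⟨fun h => ?_, ?_⟩)
    ((hl₁.mul hs₂ (summable_mul_of_summable_norm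
      (f := fun i : ℕ => z₁ ^ (i + 1) * (1 / ((i : ℂ) + 1) ^ (a + 1)))
      (g := fun n : ℤ => z₂ ^ n * (1 / (n : ℂ) ^ (b + 1))) hl₁.summable.norm hs₂.summable.norm)).of_eq
      (fun p => ?_) rfl)
  · simp only [Prod.mk.injEq] at h
    ext <;> omega
  · exact ⟨((p.1 - 1).toNat, p.2), by ext <;> simp; omega⟩
  · rintro ⟨q, rfl⟩
    simp only
    omega
  · simp only [doubleLiTerm]
    rw [show (p.1 : ℤ) + 1 = ((p.1 + 1 : ℕ) : ℤ) by push_cast; ring, zpow_natCast]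
    push_cast
    rfl

theorem hasSum_doubleLiTerm_diag {a b : ℕ} (ha : 1 ≤ a) (hb : 1 ≤ b) {z₁ z₂ : ℂ} (u₁ : ‖z₁‖ = 1)
    (u₂ : ‖z₂‖ = 1) (h₁₂ : z₁ * z₂ ∉ nonnegRay) :
    HasSum (fun p : ℤ × ℤ => if 0 < p.1 ∧ p.1 = p.2 then doubleLiTerm (a + 1) (b + 1) z₁ z₂ p else 0)
      (polyLiCont (a + b + 2) ![z₁ * z₂]) := by
  have u₁₂ : ‖z₁ * z₂‖ = 1 := by rw [norm_mul, u₁, u₂, one_mul]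
  refine hasSum_ite_of_injective (g := fun i : ℕ => ((i : ℤ) + 1, (i : ℤ) + 1))
    (fun p q h => ?_) (fun p => ⟨fun h => ?_, ?_⟩)
    ((hasSum_polyLiCont_circle (show 2 ≤ a + b + 2 by omega) h₁₂ u₁₂).of_eq (fun i => ?_) rfl)
  · simp only [Prod.mk.injEq] at h
    omega
  · obtain ⟨h0, h'⟩ := h
    exact ⟨(p.1 - 1).toNat, Prod.ext (by simp; omega) (by simp; omega)⟩
  · rintro ⟨q, rfl⟩
    exact ⟨by simp only; omega, rfl⟩
  · simp only [doubleLiTerm]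
    rw [show (i : ℤ) + 1 = ((i + 1 : ℕ) : ℤ) by push_cast; ring, zpow_natCast, zpow_natCast]
    push_cast
    rw [show a + b + 2 = (a + 1) + (b + 1) by ring, pow_add _ (a + 1), mul_pow]
    simp only [div_eq_mul_inv, mul_inv]
    ring

/-- On the line `p.1 - p.2 = l` the term is `z₂^(-l)` times a partial fraction summand in `z₁ * z₂`.
Summing the closed form over `l ≥ 1` turns the powers of `1/l` into polylogarithms. -/
theorem hasSum_doubleLiTerm_gt {a b : ℕ} (ha : 1 ≤ a) (hb : 1 ≤ b) {z₁ z₂ : ℂ} (u₁ : ‖z₁‖ = 1)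
    (u₂ : ‖z₂‖ = 1) (h₁ : z₁ ∉ nonnegRay) (h₂ : z₂ ∉ nonnegRay) (h₁₂ : z₁ * z₂ ∉ nonnegRay) :
    HasSum (fun p : ℤ × ℤ => if p.2 < p.1 then doubleLiTerm (a + 1) (b + 1) z₁ z₂ p else 0)
      ((-1) ^ b * chooseConv b (a + b + 1) (fun m => polyLiCont m ![1 / z₂])
        (fun m => berPoly m (z₁ * z₂)) +
      (-1) ^ a * chooseConv a (a + b + 1) (fun m => (-1) ^ m * polyLiCont m ![z₁])
        (fun m => berPoly m (z₁ * z₂))) := by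
  have n₂ := ne_zero_of_notMem_nonnegRay h₂
  have u₁₂ : ‖z₁ * z₂‖ = 1 := by rw [norm_mul, u₁, u₂, one_mul]
  have v₂ : ‖1 / z₂‖ = 1 := by rw [norm_div, u₂, norm_one, div_one]
  have hsE := summable_doubleLiTerm ha hb u₁ u₂ h₁ h₂
  have hg : Function.Injective fun p : ℕ × ℤ => (p.2, p.2 - ((p.1 + 1 : ℕ) : ℤ)) := by
    intro p q h
    simp only [Prod.mk.injEq] at h
    ext <;> omega
  refine hasSum_ite_of_injective hg (fun p => ⟨fun h => ?_, ?_⟩) ?_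
  · exact ⟨((p.1 - p.2 - 1).toNat, p.1), by ext <;> simp; omega⟩
  · rintro ⟨q, rfl⟩
    simp only
    omega
  · have hfib : ∀ i : ℕ, HasSum (fun n : ℤ => doubleLiTerm (a + 1) (b + 1) z₁ z₂ (n, n - ((i + 1 : ℕ) : ℤ)))
        ((1 / z₂) ^ (i + 1) * partialFractionSum (z₁ * z₂) (i + 1) a b) := fun i => by
      refine ((hasSum_zpow_partialFraction h₁₂ u₁₂ i.succ_pos a b).mul_left
        ((1 / z₂) ^ (i + 1))).of_eq (fun n => ?_) rfl
      simp only [doubleLiTerm]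
      rw [zpow_sub₀ n₂, mul_zpow, zpow_natCast]
      push_cast
      simp only [div_eq_mul_inv, inv_pow, one_mul]
      ring
    have hfib' : HasSum
        (fun i : ℕ => (1 / z₂) ^ (i + 1) * partialFractionSum (z₁ * z₂) (i + 1) a b) _ :=
      -- Absolute summability over `ℤ × ℤ` permits summing each line before summing over `l`.
      ((hsE.comp_injective hg).hasSum).prod_fiberwise hfib
    have hb' := (hasSum_chooseConv b (a + b + 1) (b := fun m => berPoly m (z₁ * z₂))
      (L := fun m => polyLiCont m ![1 / z₂])
      (fun m hm => hasSum_polyLiCont_circle (show 2 ≤ m by omega)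
        (one_div_notMem_nonnegRay h₂) v₂)).mul_left ((-1 : ℂ) ^ b)
    have ha' := (hasSum_chooseConv a (a + b + 1) (b := fun m => berPoly m (z₁ * z₂))
      (L := fun m => (-1) ^ m * polyLiCont m ![z₁])
      (fun m hm => (hasSum_polyLiCont_circle (show 2 ≤ m by omega) h₁ u₁).mul_left
        ((-1) ^ m))).mul_left ((-1 : ℂ) ^ a)
    have hsum := (hb'.add ha').of_eq (g := fun i : ℕ =>
      (1 / z₂) ^ (i + 1) * partialFractionSum (z₁ * z₂) (i + 1) a b) (fun i => ?_) rfl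
    · rw [← hfib'.unique hsum]
      exact (hsE.comp_injective hg).hasSum
    · simp only [partialFractionSum, chooseConv, Finset.mul_sum, mul_add]
      congr 1
      · refine Finset.sum_congr rfl fun j _ => ?_
        push_cast
        simp only [one_div, inv_pow]
        ring
      · refine Finset.sum_congr rfl fun j _ => ?_
        -- The factor `w ^ l` in the second half of the closed form converts `z₂^(-l)` into `z₁^l`,
        -- hence `Li_m(z₁)` in place of `Li_m(1/z₂)`.
        have e : (1 / z₂) ^ (i + 1) * (z₁ * z₂) ^ (i + 1) = z₁ ^ (i + 1) := by
          rw [← mul_pow]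
          congr 1
          field_simp
        rw [← e, neg_pow (1 / ((i + 1 : ℕ) : ℂ))]
        push_cast
        simp only [one_div, inv_pow]
        ring

theorem parityDefect_torus {a b : ℕ} (ha : 1 ≤ a) (hb : 1 ≤ b) {z₁ z₂ : ℂ} (u₁ : ‖z₁‖ = 1)
    (u₂ : ‖z₂‖ = 1) (h₁ : z₁ ∉ nonnegRay) (h₂ : z₂ ∉ nonnegRay) (h₁₂ : z₁ * z₂ ∉ nonnegRay) :
    parityDefect a b z₁ z₂ = 0 := by
  have H1 := hasSum_doubleLiTerm_lt ha hb u₁ u₂ h₂ h₁₂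
  have H2 := hasSum_doubleLiTerm_neg ha hb u₁ u₂ h₂ h₁₂
  have H3 := hasSum_doubleLiTerm_pos ha hb u₁ u₂ h₁ h₂
  have H4 := hasSum_doubleLiTerm_diag ha hb u₁ u₂ h₁₂
  have H5 := hasSum_doubleLiTerm_gt ha hb u₁ u₂ h₁ h₂ h₁₂
  have key := (H1.sub H2).unique (((H3.sub H4).sub H5).of_eq (fun p => ?_) rfl)
  · rw [parityDefect]
    linear_combination key
  -- On the axis `p.1 = 0` the indicator identity fails, but the term is zero there because `1/0 =
  -- 0`.
  · rcases eq_or_ne p.1 0 with h0 | h0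
    · simp [doubleLiTerm, h0]
    · split_ifs <;> first | omega | ring

/-! ### Assembly -/

/-- Raising both indices by one makes them at least `2`, which is what absolute convergence on the
torus requires. -/
theorem parityDefect_eq_zero (a b : ℕ) {z₁ z₂ : ℂ} (h₁ : z₁ ∉ nonnegRay) (h₂ : z₂ ∉ nonnegRay)
    (h₁₂ : z₁ * z₂ ∉ nonnegRay) : parityDefect a b z₁ z₂ = 0 := by
  refine parityDefect_eq_zero_of_succ_fst (fun z₁ z₂ h₁ h₂ h₁₂ => ?_) h₁ h₂ h₁₂
  refine parityDefect_eq_zero_of_succ_snd (fun z₁ z₂ h₁ h₂ h₁₂ => ?_) h₁ h₂ h₁₂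
  exact parityDefect_eq_zero_of_torus
    (fun z₁ z₂ u₁ u₂ h₁ h₂ h₁₂ => parityDefect_torus (by omega) (by omega) u₁ u₂ h₁ h₂ h₁₂)
    h₁ h₂ h₁₂

theorem sum_Icc_eq_chooseConv (c N : ℕ) (ℓ b : ℕ → ℂ) :
    ∑ m ∈ Finset.Icc (c + 1) (N + 1), ((m - 1).choose c : ℂ) * ℓ m * b (N + 1 - m) =
      chooseConv c N ℓ b := by
  have h := Finset.sum_Ico_add' (fun m => ((m - 1).choose c : ℂ) * ℓ m * b (N + 1 - m)) 0 (N + 1) 1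
  rw [chooseConv, Finset.range_eq_Ico]
  simp only [Nat.add_sub_cancel, Nat.add_sub_add_right] at h
  rw [h]
  refine Finset.sum_subset (fun m hm => ?_) fun m hm hm' => ?_
  · simp only [Finset.mem_Icc, Finset.mem_Ico] at hm ⊢
    omega
  · simp only [Finset.mem_Icc, Finset.mem_Ico] at hm hm'
    rw [Nat.choose_eq_zero_of_lt (by omega)]
    simp

theorem mainTheorem5 (n₁ n₂ : ℕ) (hn₁ : 1 ≤ n₁) (hn₂ : 1 ≤ n₂) (z₁ z₂ : ℂ)
    (hz₁ : z₁ ∉ nonnegRay) (hz₂ : z₂ ∉ nonnegRay) (hz₁₂ : z₁ * z₂ ∉ nonnegRay) :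
    -- all polylogarithms below are well defined by continuation along straight paths
    (MPLDefined ![n₁, n₂] ![z₁, z₂] ∧ MPLDefined ![n₁, n₂] ![1 / z₁, 1 / z₂] ∧
      ∀ m : ℕ, 1 ≤ m →
        MPLDefined ![m] ![z₁] ∧ MPLDefined ![m] ![1 / z₂] ∧ MPLDefined ![m] ![z₁ * z₂]) ∧
    parityMPL ![n₁, n₂] ![z₁, z₂] =
      mpl ![n₁, n₂] ![z₁, z₂] - (-1 : ℂ) ^ (n₁ + n₂) * mpl ![n₁, n₂] ![1 / z₁, 1 / z₂] ∧
    parityMPL ![n₁, n₂] ![z₁, z₂] =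
      (-1 : ℂ) ^ n₁ * ∑ m ∈ Finset.Icc n₁ (n₁ + n₂),
          ((m - 1).choose (n₁ - 1) : ℂ) * polyLi m z₁ * berPoly (n₁ + n₂ - m) (z₁ * z₂) *
            (-1 : ℂ) ^ m
        - polyLi (n₁ + n₂) (z₁ * z₂)
        + (-1 : ℂ) ^ n₂ * ∑ m ∈ Finset.Icc n₂ (n₁ + n₂),
          ((m - 1).choose (n₂ - 1) : ℂ) * polyLi m (1 / z₂) * berPoly (n₁ + n₂ - m) (z₁ * z₂)
        - polyLi n₁ z₁ * berPoly n₂ z₂ := by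
  have s₁ := mem_slitOne_of_notMem_nonnegRay hz₁
  have s₂ := mem_slitOne_of_notMem_nonnegRay (one_div_notMem_nonnegRay hz₂)
  have s₁₂ := mem_slitOne_of_notMem_nonnegRay hz₁₂
  have hF := isMPLContinuation_doubleLiCont n₁ n₂ (mem_doubleLiDomain hz₂ hz₁₂)
  have hF' := isMPLContinuation_doubleLiCont n₁ n₂ (mem_doubleLiDomain_inv hz₂ hz₁₂)
  have hP : parityMPL ![n₁, n₂] ![z₁, z₂] =
      mpl ![n₁, n₂] ![z₁, z₂] - (-1 : ℂ) ^ (n₁ + n₂) * mpl ![n₁, n₂] ![1 / z₁, 1 / z₂] := by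
    have e1 : (fun i => 1 / ![z₁, z₂] i) = ![1 / z₁, 1 / z₂] := by
      ext i; fin_cases i <;> simp
    -- The depth is `2`, so subtracting it from the weight leaves the sign unchanged.
    have e2 : (-1 : ℂ) ^ ((∑ i, ((![n₁, n₂] i : ℕ) : ℤ)) - ((2 : ℕ) : ℤ)) = (-1) ^ (n₁ + n₂) := by
      rw [zpow_sub₀ (by norm_num), Fin.sum_univ_two]
      simp only [Matrix.cons_val_zero, Matrix.cons_val_one, Matrix.cons_val_fin_one,
        ← Nat.cast_add, zpow_natCast]
      norm_num
    rw [parityMPL, e1, e2]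
  refine ⟨⟨⟨_, hF⟩, ⟨_, hF'⟩, fun m _ => ⟨⟨_, isMPLContinuation_polyLiCont m s₁⟩,
    ⟨_, isMPLContinuation_polyLiCont m s₂⟩, ⟨_, isMPLContinuation_polyLiCont m s₁₂⟩⟩⟩, hP, ?_⟩
  rw [hP, hF.mpl_eq, hF'.mpl_eq]
  simp only [polyLi_eq _ s₁, polyLi_eq _ s₂, polyLi_eq _ s₁₂]
  obtain ⟨a, rfl⟩ := Nat.exists_eq_add_of_le' hn₁
  obtain ⟨b, rfl⟩ := Nat.exists_eq_add_of_le' hn₂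
  have key := parityDefect_eq_zero a b hz₁ hz₂ hz₁₂
  rw [parityDefect, ← sum_Icc_eq_chooseConv, ← sum_Icc_eq_chooseConv] at key
  rw [show a + 1 + (b + 1) = a + b + 1 + 1 by ring]
  simp only [Nat.add_sub_cancel]
  have e : ∀ m, ((m - 1).choose a : ℂ) * polyLiCont m ![z₁] *
      berPoly (a + b + 1 + 1 - m) (z₁ * z₂) * (-1) ^ m = ((m - 1).choose a : ℂ) *
      ((-1) ^ m * polyLiCont m ![z₁]) * berPoly (a + b + 1 + 1 - m) (z₁ * z₂) := fun m => by ring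
  simp only [e]
  linear_combination key
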